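/- **Setting.** An expanding system $(X,d,\mathcal A,\lambda,T)$ consists of a locally complete separable metric space $(X,d)$ with Borel $\sigma$-algebra $\mathcal A$, a finite non-atomic measure $\lambda$ on $\mathcal A$ with support $X$, and a measurable map $T:X\to X$ such that the following hold. (A) There is a collection $\mathcal P_0=\{P_i\}$ of open sets with $\sup_i\operatorname{diam}P_i<\infty$ such that: $\lambda(P_i)>0$; $P_i\cap P_j=\emptyset$ for $i\ne j$; $\lambda(X\setminus\bigcup_iP_i)=0$; $T|_{P_i}$ is injective; if $P_j\cap T(P_i)\neq\emptyset$ then $P_j\subseteq T(P_i)$; if $P_j\subseteq T(P_i)$ then $(T|_{P_i})^{-1}:T(P_i)\cap P_j\to P_i$ is open; and there is $n_0>0$ with $\lambda(T^{-n_0}(P_i)\cap P_j)>0$ for all $i,j$. (B) There is a measurable $\mathbf J:X\to[0,\infty)$, positive on $\bigcup_iP_i$, with $\lambda(T(A))=\int_A\mathbf J\,d\lambda$ for all Borel $A\subseteq P_i$ and all $i$, and there are constants $0<\alpha\le1$, $C_1>0$ with $|\mathbf J(x)/\mathbf J(y)-1|\le C_1\,d(T(x),T(y))^\alpha$ for all $x,y\in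 P_i$ and all $i$. (C) With $\mathcal P_{n}=\{(T|_{P})^{-1}(Q):P\in\mathcal P_0,\ Q\in\mathcal P_{n-1},\ Q\subseteq T(P)\}$ for $n\ge1$, there are constants $\beta>1$, $C_2>0$ with $d(T^n(x),T^n(y))\ge C_2\beta^n d(x,y)$ whenever $x,y$ lie in the same element of $\mathcal P_n$, $n\ge 0$. The ACIPM $\mu$ of the system is its unique $T$-invariant Borel probability measure absolutely continuous with respect to $\lambda$, and $h_\mu=h_\mu(T)$ is the measure-theoretic entropy. Let $X_0=\bigcap_n\bigcup_{P\in\mathcal P_n}P$ and, for $x\in X_0$, let $P(n,x)$ be the element of $\mathcal P_n$ containing $x$. Let $X_0^+$ be the union of $X_0$ and the set of all $x\in X$ for which there are $P_n\in\mathcal P_n$ with $P_{n+1}\subseteq P_n$ and $\bigcap_n\overline{P_n}=\{x\}$; for each $x\in X_0^+\setminus X_0$ any such sequence is chosen and $P(n,x):=P_n$. Let $$X_1=\Big\{x\in X_0:\ \forall m\ge1\ \exists N\ \forall j\ge N,\ \ \Big|\tfrac1j\log\tfrac1{\mu(P(j,x))}-h_\mu(T,\mathcal P_0)\Big|<\tfrac1m\Big\},$$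 where $h_\mu(T,\mathcal P_0)$ is the entropy of $T$ with respect to the partition $\mathcal P_0$. For a finite measure $\nu$, $0<\alpha\le1$ and $F\subseteq X$, with $\mathbf\Pi=\{\mathcal P_n\}$, put $$\mathcal H^\alpha_{\mathbf\Pi,\nu}(F)=\lim_{n\to\infty}\inf\sum_i\nu(P_i)^\alpha,$$ the infimum being over the coverings $\{P_i\}$ of $F$ by sets $P_i\in\bigcup_{k\ge n}\mathcal P_k$, and $\operatorname{Dim}_{\mathbf\Pi,\nu}(F)=\sup\{\alpha\in(0,1]:\mathcal H^\alpha_{\mathbf\Pi,\nu}(F)>0\}$ (with $\sup\emptyset=0$). **Proposition.** Let $(X,d,\mathcal A,\lambda,T)$ be an expanding system whose partition $\mathcal P_0$ is finite, with $D$ elements, and let $\mu$ be its ACIPM. Let $\{t_n\}$ be a nondecreasing sequence of positive integers, $U\subseteq X$ an open set with $\mu(U)>0$, $x_0\in X_0^+$, and $$\widetilde{\mathcal W}=\widetilde{\mathcal W}(U,x_0,\{t_n\})=\{x\in U\cap X_0:\ T^k(x)\in P(t_k,x_0)\text{ for infinitely many }k\}.$$ Then $$\operatorname{Dim}_{\mathbf\Pi,\lambda}(\widetilde{\mathcal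 W})=\operatorname{Dim}_{\mathbf\Pi,\mu}(\widetilde{\mathcal W})\le\min\Big\{1,\frac{\log D}{h_\mu+\underline L(x_0)}\Big\},\qquad \underline L(x_0)=\liminf_{n\to\infty}\frac1n\log\frac1{\lambda(P(t_n,x_0))}\in[0,\infty].$$ Moreover, if $x_0\in X_1$, then $$\operatorname{Dim}_{\mathbf\Pi,\lambda}(\widetilde{\mathcal W})=\operatorname{Dim}_{\mathbf\Pi,\mu}(\widetilde{\mathcal W})\le\min\Big\{1,\frac{\log D}{(1+\underline w)\,h_\mu}\Big\},\qquad \underline w=\liminf_{n\to\infty}\frac{t_n}n\in[0,\infty].$$ (When the denominator is $+\infty$ the fraction is $0$.) -/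

import Mathlib

open MeasureTheory Filter Topology
open scoped ENNReal

namespace ExpandingMaps

/-! ### Grid measures and grid dimension -/

/-- The infimum of `∑ ν(P)^α` over the coverings of `F` by sets belonging to `⋃_{k ≥ n} Π k`.
A covering is given by the set `C` of its members. -/
noncomputable def gridPreMeasure {X : Type*} [MeasurableSpace X] (grid : ℕ → Set (Set X))
    (ν : Measure X) (α : ℝ) (n : ℕ) (F : Set X) : ℝ≥0∞ :=
  ⨅ (C : Set (Set X)) (_ : C ⊆ ⋃ k ≥ n, grid k) (_ : F ⊆ ⋃₀ C), ∑' P : C, ν (P : Set X) ^ α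

/-- The `α`-dimensional `ν`-grid measure: the limit as `n → ∞` of `gridPreMeasure`, which is
nondecreasing in `n`, hence the supremum. -/
noncomputable def gridMeasure {X : Type*} [MeasurableSpace X] (grid : ℕ → Set (Set X))
    (ν : Measure X) (α : ℝ) (F : Set X) : ℝ≥0∞ :=
  ⨆ n : ℕ, gridPreMeasure grid ν α n F

/-- The `ν`-grid Hausdorff dimension `sup {α ∈ (0, 1] : gridMeasure α F > 0}`, the supremum of the
empty set being `0`.  For finite `ν` it equals `inf {α ∈ (0, 1] : gridMeasure α F = 0}`, the infimum
of the empty set being `1`. -/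
noncomputable def gridDim {X : Type*} [MeasurableSpace X] (grid : ℕ → Set (Set X))
    (ν : Measure X) (F : Set X) : ℝ≥0∞ :=
  ⨆ (α : ℝ) (_ : 0 < α) (_ : α ≤ 1) (_ : 0 < gridMeasure grid ν α F), ENNReal.ofReal α

/-! ### Entropy -/

/-- A partition of a measure space: measurable sets of positive measure, pairwise disjoint and
covering the space up to null sets.  For a finite measure such a family is countable. -/
structure IsMeasPartition {X : Type*} [MeasurableSpace X] (μ : Measure X) (Q : Set (Set X)) :
    Prop where
  measurable : ∀ A ∈ Q, MeasurableSet A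
  pos : ∀ A ∈ Q, 0 < μ A
  inter_null : ∀ A ∈ Q, ∀ B ∈ Q, A ≠ B → μ (A ∩ B) = 0
  compl_null : μ (⋃₀ Q)ᶜ = 0

/-- The entropy `∑ μ(A) log (1 / μ(A))` of a partition, for a probability measure `μ`
(all terms are then nonnegative). -/
noncomputable def partitionEntropy {X : Type*} [MeasurableSpace X] (μ : Measure X)
    (Q : Set (Set X)) : ℝ≥0∞ :=
  ∑' A : Q, ENNReal.ofReal (μ.real (A : Set X) * Real.log (1 / μ.real (A : Set X)))

/-- The join `⋁_{j < n} T^{-j} Q`: the intersections `⋂_{j < n} T^{-j} (a j)`, with every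
`a j ∈ Q`, that have positive measure. -/
def iteratedJoin {X : Type*} [MeasurableSpace X] (μ : Measure X) (T : X → X)
    (Q : Set (Set X)) (n : ℕ) : Set (Set X) :=
  {A | 0 < μ A ∧ ∃ a : Fin n → Set X, (∀ j, a j ∈ Q) ∧ A = ⋂ j : Fin n, T^[(j : ℕ)] ⁻¹' a j}

/-- The entropy `h_μ(T, Q)` of `T` with respect to the partition `Q`: the limit of
`(1 / n) H_μ(⋁_{j < n} T^{-j} Q)`.  The limit exists when `T` preserves the probability `μ`;
it is written as a `limsup`. -/
noncomputable def entropyWrt {X : Type*} [MeasurableSpace X] (μ : Measure X) (T : X → X)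
    (Q : Set (Set X)) : ℝ≥0∞ :=
  limsup (fun n : ℕ => partitionEntropy μ (iteratedJoin μ T Q n) / (n : ℝ≥0∞)) atTop

/-- The entropy `h_μ(T)`: the supremum of `h_μ(T, Q)` over the partitions `Q` of finite entropy. -/
noncomputable def measureEntropy {X : Type*} [MeasurableSpace X] (μ : Measure X) (T : X → X) :
    ℝ≥0∞ :=
  ⨆ (Q : Set (Set X)) (_ : IsMeasPartition μ Q) (_ : partitionEntropy μ Q < ⊤), entropyWrt μ T Q

/-! ### Expanding systems -/

/-- The families `𝒫_n`: `𝒫_0` is given, and `𝒫_{n+1}` consists of the sets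
`(T|_P)⁻¹(Q) = P ∩ T⁻¹(Q)` with `P ∈ 𝒫_0`, `Q ∈ 𝒫_n` and `Q ⊆ T(P)`. -/
def blocks {X : Type*} (T : X → X) (P0 : Set (Set X)) : ℕ → Set (Set X)
  | 0 => P0
  | n + 1 => {A | ∃ P ∈ P0, ∃ Q ∈ blocks T P0 n, Q ⊆ T '' P ∧ A = P ∩ T ⁻¹' Q}

/-- `(X, d, 𝒜, lam, T)` is an expanding system with initial partition `P0`;
`𝒜` is the Borel `σ`-algebra. -/
structure IsExpandingSystem {X : Type*} [MetricSpace X] [MeasurableSpace X] [BorelSpace X]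
    (lam : Measure X) (T : X → X) (P0 : Set (Set X)) : Prop where
  separable : TopologicalSpace.SeparableSpace X
  locally_complete : ∀ x : X, ∃ V ∈ 𝓝 x, IsComplete V
  finite_measure : IsFiniteMeasure lam
  non_atomic : NullSingletonClass lam
  full_support : lam.IsOpenPosMeasure
  measurable_map : Measurable T
  /- (A) the initial partition -/
  isOpen_of_mem : ∀ P ∈ P0, IsOpen P
  diam_bounded : ∃ R : ℝ, ∀ P ∈ P0, ∀ x ∈ P, ∀ y ∈ P, dist x y ≤ R
  measure_pos : ∀ P ∈ P0, 0 < lam P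
  disjoint : ∀ P ∈ P0, ∀ Q ∈ P0, P ≠ Q → P ∩ Q = ∅
  compl_null : lam (⋃₀ P0)ᶜ = 0
  injOn : ∀ P ∈ P0, Set.InjOn T P
  markov : ∀ P ∈ P0, ∀ Q ∈ P0, (Q ∩ T '' P).Nonempty → Q ⊆ T '' P
  /- the inverse branch `(T|_P)⁻¹ : T(P) ∩ Q → P` is an open map -/
  inverse_open : ∀ P ∈ P0, ∀ Q ∈ P0, Q ⊆ T '' P →
    ∀ V : Set X, IsOpen V → V ⊆ Q → IsOpen (P ∩ T ⁻¹' V)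
  transitive : ∃ n₀ : ℕ, 0 < n₀ ∧ ∀ P ∈ P0, ∀ Q ∈ P0, 0 < lam (T^[n₀] ⁻¹' P ∩ Q)
  /- (B) the Jacobian -/
  jacobian : ∃ J : X → ℝ, Measurable J ∧ (∀ x, 0 ≤ J x) ∧ (∀ P ∈ P0, ∀ x ∈ P, 0 < J x) ∧
    (∀ P ∈ P0, ∀ A : Set X, MeasurableSet A → A ⊆ P →
      lam (T '' A) = ∫⁻ x in A, ENNReal.ofReal (J x) ∂lam) ∧
    ∃ α C₁ : ℝ, 0 < α ∧ α ≤ 1 ∧ 0 < C₁ ∧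
      ∀ P ∈ P0, ∀ x ∈ P, ∀ y ∈ P, |J x / J y - 1| ≤ C₁ * dist (T x) (T y) ^ α
  /- (C) expansion -/
  expanding : ∃ β C₂ : ℝ, 1 < β ∧ 0 < C₂ ∧
    ∀ n : ℕ, ∀ P ∈ blocks T P0 n, ∀ x ∈ P, ∀ y ∈ P,
      C₂ * β ^ n * dist x y ≤ dist (T^[n] x) (T^[n] y)

/-- `μ` is the absolutely continuous invariant probability measure (ACIPM) of the system.  For an
expanding system there is exactly one such measure. -/
structure IsACIPM {X : Type*} [MeasurableSpace X] (lam : Measure X) (T : X → X)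
    (μ : Measure X) : Prop where
  probability : IsProbabilityMeasure μ
  abs_cont : μ ≪ lam
  invariant : MeasurePreserving T μ μ

/-- `X_0 = ⋂_n ⋃ 𝒫_n`. -/
def X0 {X : Type*} (T : X → X) (P0 : Set (Set X)) : Set X :=
  ⋂ n : ℕ, ⋃₀ blocks T P0 n

/-- `P(n, x)`: the element of `𝒫_n` that contains `x`, for `x ∈ ⋃ 𝒫_n` (the members of `𝒫_n` are
pairwise disjoint). -/
def block {X : Type*} (T : X → X) (P0 : Set (Set X)) (n : ℕ) (x : X) : Set X :=
  ⋃₀ {P | P ∈ blocks T P0 n ∧ x ∈ P}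

/-- `P` is a nested sequence of elements `P n ∈ 𝒫_n` with `⋂ closure (P n) = {x}`. -/
def IsNestedSeqAt {X : Type*} [TopologicalSpace X] (T : X → X) (P0 : Set (Set X)) (x : X)
    (P : ℕ → Set X) : Prop :=
  (∀ n, P n ∈ blocks T P0 n) ∧ (∀ n, P (n + 1) ⊆ P n) ∧ ⋂ n, closure (P n) = {x}

/-- `X_0^+`: the points of `X_0` and the points that are the intersection of the closures of a
nested sequence of elements of the `𝒫_n`. -/
def X0plus {X : Type*} [TopologicalSpace X] (T : X → X) (P0 : Set (Set X)) : Set X :=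
  X0 T P0 ∪ {x | ∃ P : ℕ → Set X, IsNestedSeqAt T P0 x P}

/-- `P` is an admissible choice of the sequence `n ↦ P(n, x)` at a point `x ∈ X_0^+`: it is
`n ↦ block n x` if `x ∈ X_0`, and any nested sequence at `x` if `x ∈ X_0^+ \ X_0`. -/
def IsBlockSeq {X : Type*} [TopologicalSpace X] (T : X → X) (P0 : Set (Set X)) (x : X)
    (P : ℕ → Set X) : Prop :=
  (x ∈ X0 T P0 ∧ ∀ n, P n = block T P0 n x) ∨ (x ∉ X0 T P0 ∧ IsNestedSeqAt T P0 x P)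

/-- `E_N^ε`: the set of the points `x` such that, for some `j ≥ N`, it is not true that
`|(1 / j) log (1 / μ(P(j, x))) - h_μ(T, 𝒫_0)| < ε`. -/
def badSet {X : Type*} [MeasurableSpace X] (μ : Measure X) (T : X → X) (P0 : Set (Set X))
    (ε : ℝ) (N : ℕ) : Set X :=
  {x | ∃ j ≥ N, ¬ |1 / (j : ℝ) * Real.log (1 / μ.real (block T P0 j x))
    - (entropyWrt μ T P0).toReal| < ε}

/-- `X_1 = X_0 \ ⋃_{m ≥ 1} ⋂_N E_N^{1/m}`. -/
def X1 {X : Type*} [MeasurableSpace X] (μ : Measure X) (T : X → X) (P0 : Set (Set X)) : Set X :=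
  X0 T P0 \ ⋃ m : ℕ, ⋂ N : ℕ, badSet μ T P0 (1 / ((m : ℝ) + 1)) N

/-- The points `x ∈ U ∩ X_0` with `T^k x ∈ P(t_k, x₀)` for infinitely many `k`, where `P` is the
sequence `n ↦ P(n, x₀)`. -/
def shrinkingTargetSet {X : Type*} (T : X → X) (P0 : Set (Set X)) (U : Set X) (P : ℕ → Set X)
    (t : ℕ → ℕ) : Set X :=
  {x | x ∈ U ∩ X0 T P0 ∧ ∃ᶠ k in atTop, T^[k] x ∈ P (t k)}

/-- `liminf_n (1 / n) log (1 / lam(P(t_n, x₀)))`, an element of `[0, ∞]`: the liminf is taken in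
the extended reals, and it is nonnegative because `lam` is finite. -/
noncomputable def lowerL {X : Type*} [MeasurableSpace X] (lam : Measure X) (P : ℕ → Set X)
    (t : ℕ → ℕ) : ℝ≥0∞ :=
  (liminf (fun n : ℕ => ((1 / (n : ℝ) * Real.log (1 / lam.real (P (t n))) : ℝ) : EReal))
    atTop).toENNReal

/-- `liminf_n t_n / n`, an element of `[0, ∞]`. -/
noncomputable def lowerW (t : ℕ → ℕ) : ℝ≥0∞ :=
  liminf (fun n : ℕ => (t n : ℝ≥0∞) / (n : ℝ≥0∞)) atTop

end ExpandingMaps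

open scoped NNReal

/-! Upper bound. A point of `X0` that hits its target at time k lies in T^{-k}(P(t_k, x₀)), which
the words of length k cut into at most D^k blocks of level t_k + k. These are disjoint and, by
invariance, have total μ-mass at most μ(P(t_k, x₀)); concavity of s ↦ s^α then bounds the sum of
their α-th powers by D^{k(1-α)} μ(P(t_k, x₀))^α (`IsExpandingSystem.exists_cover`). If λ(P(t_k, x₀))
≤ e^{-kr} eventually, this decays geometrically as soon as log D < α (log D + r), and a
Borel–Cantelli argument makes the α-grid measure vanish. Letting r increase to L gives the bound log
D / (log D + L), which implies the stated one because h_μ ≤ log D.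

Comparison of λ and μ (`IsACIPM.exists_comparable`). The density of μ is approximated in L¹ by
functions constant on the cylinders of level m. Since μ(S) = μ(T^{-m}S), it suffices to know which
share of each cylinder T^{-m}S occupies: by bounded distortion, at most a constant times λ(S), and,
after n₀ further iterates granted by transitivity, at least a constant times λ(S). Hence both
measures give the same grid dimension.

Entropy. Cylinders over `P0` approximate all measurable sets, so h_μ(T) ≤ h_μ(T, `P0`)
(`IsACIPM.measureEntropy_le_entropyWrt`), and counting words gives h_μ(T, `P0`) ≤ log D. At a point
of `X1` the masses μ(P(j, x₀)) decay at rate h_μ(T, `P0`), whence L ≥ w h_μ(T, `P0`) ≥ w h_μ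
(`IsACIPM.lowerW_mul_le_lowerL`). -/

namespace ExpandingMaps

/-! ### Symbolic description of the blocks by cylinders. -/

variable {X : Type*}

/-- The cylinder `⋂_{j < n} T^{-j} (b j)`. -/
def cyl (T : X → X) {n : ℕ} (b : Fin n → Set X) : Set X := ⋂ j : Fin n, T^[(j : ℕ)] ⁻¹' b j

lemma mem_cyl {T : X → X} {n : ℕ} {b : Fin n → Set X} {x : X} :
    x ∈ cyl T b ↔ ∀ j : Fin n, T^[(j : ℕ)] x ∈ b j := by
  simp [cyl]

lemma mem_cyl_succ {T : X → X} {n : ℕ} {b : Fin (n + 1) → Set X} {x : X} :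
    x ∈ cyl T b ↔ x ∈ b 0 ∧ T x ∈ cyl T (Fin.tail b) := by
  simp [mem_cyl, Fin.forall_fin_succ, Fin.tail]

lemma mem_cyl_succ_last {T : X → X} {n : ℕ} {b : Fin (n + 1) → Set X} {x : X} :
    x ∈ cyl T b ↔ x ∈ cyl T (Fin.init b) ∧ T^[n] x ∈ b (Fin.last n) := by
  simp [mem_cyl, Fin.forall_fin_succ', Fin.init]

lemma measurableSet_cyl [MeasurableSpace X] {T : X → X} (hT : Measurable T) {n : ℕ}
    {b : Fin n → Set X} (hb : ∀ j, MeasurableSet (b j)) : MeasurableSet (cyl T b) :=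
  MeasurableSet.iInter fun j => hT.iterate _ (hb j)

lemma disjoint_cyl {T : X → X} {P0 : Set (Set X)}
    (hd : ∀ P ∈ P0, ∀ Q ∈ P0, P ≠ Q → P ∩ Q = ∅) {n : ℕ} {b c : Fin n → P0} (hbc : b ≠ c) :
    Disjoint (cyl T fun j => (b j : Set X)) (cyl T fun j => (c j : Set X)) := by
  rw [Set.disjoint_left]
  intro x hx hy
  rw [mem_cyl] at hx hy
  refine hbc (funext fun j => ?_)
  by_contra hj
  have := hd _ (b j).2 _ (c j).2 (fun h => hj (Subtype.ext h))
  exact (this ▸ Set.mem_inter (hx j) (hy j) : _ ∈ (∅ : Set X))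

lemma exists_superset_of_mem_blocks {T : X → X} {P0 : Set (Set X)} {n : ℕ} {B : Set X}
    (hB : B ∈ blocks T P0 n) : ∃ P ∈ P0, B ⊆ P := by
  cases n with
  | zero => exact ⟨B, hB, subset_rfl⟩
  | succ n =>
    obtain ⟨P, hP, Q, -, -, rfl⟩ := hB
    exact ⟨P, hP, Set.inter_subset_left⟩

/-- Index shift: a block of level `n` is described by a word of `n + 1` letters. -/
lemma exists_cyl_of_mem_blocks {T : X → X} {P0 : Set (Set X)} {n : ℕ} {B : Set X}
    (hB : B ∈ blocks T P0 n) : ∃ b : Fin (n + 1) → P0, B = cyl T fun j => (b j : Set X) := by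
  induction n generalizing B with
  | zero =>
    refine ⟨fun _ => ⟨B, hB⟩, ?_⟩
    ext x
    simp [mem_cyl]
  | succ n ih =>
    obtain ⟨P, hP, Q, hQ, -, rfl⟩ := hB
    obtain ⟨b, rfl⟩ := ih hQ
    refine ⟨Fin.cons ⟨P, hP⟩ b, ?_⟩
    ext x
    rw [mem_cyl_succ]
    rfl

lemma mapsTo_of_mem_blocks {T : X → X} {P0 : Set (Set X)} {n : ℕ} {B : Set X}
    (hB : B ∈ blocks T P0 n) : ∃ P ∈ P0, B ⊆ T^[n] ⁻¹' P := by
  obtain ⟨b, rfl⟩ := exists_cyl_of_mem_blocks hB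
  exact ⟨_, (b (Fin.last n)).2, fun x hx => (mem_cyl.1 hx (Fin.last n) :)⟩

/-- Prepending one letter `P` to a block needs the whole block inside T(P). The Markov property
supplies this from a single common point, applied to the element of `P0` that contains the block. -/
lemma pullback_mem_blocks {T : X → X} {P0 : Set (Set X)}
    (hm : ∀ P ∈ P0, ∀ Q ∈ P0, (Q ∩ T '' P).Nonempty → Q ⊆ T '' P) {t : ℕ} {R : Set X}
    (hR : R ∈ blocks T P0 t) {k : ℕ} (b : Fin k → Set X) (hb : ∀ j, b j ∈ P0)
    (hne : (cyl T b ∩ T^[k] ⁻¹' R).Nonempty) : cyl T b ∩ T^[k] ⁻¹' R ∈ blocks T P0 (t + k) := by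
  induction k with
  | zero =>
    have : cyl T b = Set.univ := by ext x; simp [mem_cyl]
    simpa [this] using hR
  | succ k ih =>
    have key : cyl T b ∩ T^[k + 1] ⁻¹' R
        = b 0 ∩ T ⁻¹' (cyl T (Fin.tail b) ∩ T^[k] ⁻¹' R) := by
      ext x
      simp [mem_cyl_succ, and_assoc]
    rw [key] at hne ⊢
    obtain ⟨x, hx0, hx1⟩ := hne
    have h1 := ih (Fin.tail b) (fun j => hb _) ⟨_, hx1⟩
    refine ⟨b 0, hb 0, _, h1, ?_, rfl⟩
    obtain ⟨Q, hQ, hsub⟩ := exists_superset_of_mem_blocks h1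
    exact hsub.trans (hm _ (hb 0) _ hQ ⟨T x, hsub hx1, x, hx0, rfl⟩)

lemma cyl_mem_blocks {T : X → X} {P0 : Set (Set X)}
    (hm : ∀ P ∈ P0, ∀ Q ∈ P0, (Q ∩ T '' P).Nonempty → Q ⊆ T '' P)
    {n : ℕ} (b : Fin (n + 1) → Set X) (hb : ∀ j, b j ∈ P0) (hne : (cyl T b).Nonempty) :
    cyl T b ∈ blocks T P0 n := by
  have key : cyl T b = cyl T (Fin.init b) ∩ T^[n] ⁻¹' b (Fin.last n) := by
    ext x; simp [mem_cyl_succ_last]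
  rw [key] at hne ⊢
  simpa using pullback_mem_blocks hm (t := 0) (hb (Fin.last n)) (Fin.init b) (fun j => hb _) hne

/-- The points whose whole orbit stays in `⋃ P0` lie in `X0`. -/
lemma mem_X0_of_forall {T : X → X} {P0 : Set (Set X)}
    (hm : ∀ P ∈ P0, ∀ Q ∈ P0, (Q ∩ T '' P).Nonempty → Q ⊆ T '' P) {x : X}
    (hx : ∀ n, T^[n] x ∈ ⋃₀ P0) : x ∈ X0 T P0 := by
  choose b hb hbx using hx
  refine Set.mem_iInter.2 fun n => ?_
  have hmem : x ∈ cyl T fun j : Fin (n + 1) => b j := mem_cyl.2 fun j => hbx j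
  exact ⟨_, cyl_mem_blocks hm _ (fun j => hb j) ⟨x, hmem⟩, hmem⟩

lemma iterate_mem_of_mem_X0 {T : X → X} {P0 : Set (Set X)} {x : X} (hx : x ∈ X0 T P0) (n : ℕ) :
    T^[n] x ∈ ⋃₀ P0 := by
  obtain ⟨B, hB, hxB⟩ := Set.mem_iInter.1 hx n
  obtain ⟨P, hP, hsub⟩ := mapsTo_of_mem_blocks hB
  exact ⟨P, hP, hsub hxB⟩

lemma exists_mem_cyl_of_mem_X0 {T : X → X} {P0 : Set (Set X)} {x : X} (hx : x ∈ X0 T P0) (n : ℕ) :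
    ∃ b : Fin n → P0, x ∈ cyl T fun j => (b j : Set X) := by
  choose b hb hbx using iterate_mem_of_mem_X0 hx
  exact ⟨fun j => ⟨b j, hb j⟩, mem_cyl.2 fun j => hbx j⟩

lemma X0_compl_null [MeasurableSpace X] {T : X → X} {P0 : Set (Set X)}
    (hm : ∀ P ∈ P0, ∀ Q ∈ P0, (Q ∩ T '' P).Nonempty → Q ⊆ T '' P)
    {ν : Measure X} (hT : Measure.QuasiMeasurePreserving T ν ν) (h0 : ν (⋃₀ P0)ᶜ = 0) :
    ν (X0 T P0)ᶜ = 0 := by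
  have : ∀ᵐ x ∂ν, ∀ n, T^[n] x ∈ ⋃₀ P0 := ae_all_iff.2 fun n => (hT.iterate n).ae h0
  refine measure_mono_null ?_ this
  intro x hx hx'
  exact hx (mem_X0_of_forall hm hx')

lemma block_eq_of_mem {T : X → X} {P0 : Set (Set X)}
    (hd : ∀ P ∈ P0, ∀ Q ∈ P0, P ≠ Q → P ∩ Q = ∅) {n : ℕ} {B : Set X} {x : X}
    (hB : B ∈ blocks T P0 n) (hx : x ∈ B) : block T P0 n x = B := by
  have : {P | P ∈ blocks T P0 n ∧ x ∈ P} = {B} := by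
    ext P
    constructor
    · rintro ⟨hP, hxP⟩
      obtain ⟨b, rfl⟩ := exists_cyl_of_mem_blocks hB
      obtain ⟨c, rfl⟩ := exists_cyl_of_mem_blocks hP
      by_contra hne
      have : b ≠ c := by rintro rfl; exact hne rfl
      exact Set.disjoint_left.1 (disjoint_cyl hd this) hx hxP
    · rintro rfl
      exact ⟨hB, hx⟩
  rw [block, this, Set.sUnion_singleton]

lemma block_mem_blocks {T : X → X} {P0 : Set (Set X)}
    (hd : ∀ P ∈ P0, ∀ Q ∈ P0, P ≠ Q → P ∩ Q = ∅) {x : X} (hx : x ∈ X0 T P0) (n : ℕ) :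
    block T P0 n x ∈ blocks T P0 n := by
  obtain ⟨B, hB, hxB⟩ := Set.mem_iInter.1 hx n
  rwa [block_eq_of_mem hd hB hxB]

/-! ### Null sets, positivity of blocks and bounded distortion. -/

section System

variable [MetricSpace X] [MeasurableSpace X] [BorelSpace X] {lam : Measure X} {T : X → X}
  {P0 : Set (Set X)}

lemma IsExpandingSystem.measurableSet_of_mem (h : IsExpandingSystem lam T P0) {P : Set X}
    (hP : P ∈ P0) : MeasurableSet P := (h.isOpen_of_mem P hP).measurableSet

lemma IsExpandingSystem.measurableSet_of_mem_blocks (h : IsExpandingSystem lam T P0) {n : ℕ}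
    {B : Set X} (hB : B ∈ blocks T P0 n) : MeasurableSet B := by
  obtain ⟨b, rfl⟩ := exists_cyl_of_mem_blocks hB
  exact measurableSet_cyl h.measurable_map fun j => h.measurableSet_of_mem (b j).2

/-- The diameters of the elements of `blocks T P0 n` tend to `0` uniformly. -/
lemma IsExpandingSystem.exists_dist_le (h : IsExpandingSystem lam T P0) :
    ∃ c γ : ℝ, 0 ≤ c ∧ 0 ≤ γ ∧ γ < 1 ∧
      ∀ n, ∀ B ∈ blocks T P0 n, ∀ x ∈ B, ∀ y ∈ B, dist x y ≤ c * γ ^ n := by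
  obtain ⟨R, hR⟩ := h.diam_bounded
  obtain ⟨β, C₂, hβ, hC, hexp⟩ := h.expanding
  have hβ0 : 0 < β := by linarith
  refine ⟨max R 0 / C₂, β⁻¹, by positivity, by positivity, inv_lt_one_of_one_lt₀ hβ, ?_⟩
  intro n B hB x hx y hy
  obtain ⟨P, hP, hsub⟩ := mapsTo_of_mem_blocks hB
  have h1 := hexp n B hB x hx y hy
  have h2 := hR P hP _ (hsub hx) _ (hsub hy)
  have h3 : C₂ * β ^ n * dist x y ≤ max R 0 := h1.trans (h2.trans (le_max_left _ _))
  rw [inv_pow, ← div_eq_mul_inv, div_div, le_div_iff₀ (by positivity)]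
  linarith

/-- On each `P`, the integral of the Jacobian over P ∩ T⁻¹(N) is at most λ(N) = 0, and the Jacobian
is positive there. -/
lemma IsExpandingSystem.quasiMeasurePreserving (h : IsExpandingSystem lam T P0) (hfin : P0.Finite) :
    Measure.QuasiMeasurePreserving T lam lam := by
  refine ⟨h.measurable_map, Measure.AbsolutelyContinuous.mk fun N hN hN0 => ?_⟩
  rw [Measure.map_apply h.measurable_map hN]
  obtain ⟨J, hJm, -, hJpos, hJ, -⟩ := h.jacobian
  have hsub : T ⁻¹' N ⊆ (⋃₀ P0)ᶜ ∪ ⋃ P ∈ P0, (P ∩ T ⁻¹' N) := by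
    intro x hx
    by_cases hx0 : x ∈ ⋃₀ P0
    · obtain ⟨P, hP, hxP⟩ := hx0
      exact Or.inr (Set.mem_biUnion hP ⟨hxP, hx⟩)
    · exact Or.inl hx0
  refine measure_mono_null hsub (measure_union_null h.compl_null ?_)
  refine (measure_biUnion_null_iff hfin.countable).2 fun P hP => ?_
  have hA : MeasurableSet (P ∩ T ⁻¹' N) :=
    (h.measurableSet_of_mem hP).inter (h.measurable_map hN)
  have h1 := hJ P hP _ hA Set.inter_subset_left
  have h2 : lam (T '' (P ∩ T ⁻¹' N)) = 0 :=
    measure_mono_null (by rintro _ ⟨x, hx, rfl⟩; exact hx.2) hN0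
  rw [h2] at h1
  have h3 := (setLIntegral_eq_zero_iff hA hJm.ennreal_ofReal).1 h1.symm
  have h4 : ∀ᵐ x ∂lam, x ∉ P ∩ T ⁻¹' N := by
    filter_upwards [h3] with x hx hxA
    have := hx hxA
    rw [ENNReal.ofReal_eq_zero] at this
    exact absurd (hJpos P hP x hxA.1) (not_lt.2 this)
  exact measure_eq_zero_iff_ae_notMem.2 h4

lemma IsExpandingSystem.setLIntegral_jacobian {J : X → ℝ}
    (h : IsExpandingSystem lam T P0)
    (hJ : ∀ P ∈ P0, ∀ A : Set X, MeasurableSet A → A ⊆ P →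
      lam (T '' A) = ∫⁻ x in A, ENNReal.ofReal (J x) ∂lam)
    {P E : Set X} (hP : P ∈ P0) (hE : MeasurableSet E) (hEP : E ⊆ T '' P) :
    lam E = ∫⁻ x in P ∩ T ⁻¹' E, ENNReal.ofReal (J x) ∂lam := by
  rw [← hJ P hP _ ((h.measurableSet_of_mem hP).inter (h.measurable_map hE)) Set.inter_subset_left]
  congr 1
  ext y
  constructor
  · intro hy
    obtain ⟨x, hx, rfl⟩ := hEP hy
    exact ⟨x, ⟨hx, hy⟩, rfl⟩
  · rintro ⟨x, hx, rfl⟩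
    exact hx.2

lemma IsExpandingSystem.measure_block_pos (h : IsExpandingSystem lam T P0) {n : ℕ} {B : Set X}
    (hB : B ∈ blocks T P0 n) : 0 < lam B := by
  induction n generalizing B with
  | zero => exact h.measure_pos B hB
  | succ n ih =>
    obtain ⟨P, hP, Q, hQ, hsub, rfl⟩ := hB
    obtain ⟨J, hJm, -, -, hJ, -⟩ := h.jacobian
    have h1 := h.setLIntegral_jacobian hJ hP (h.measurableSet_of_mem_blocks hQ) hsub
    have h2 := ih hQ
    rw [pos_iff_ne_zero]
    intro h0
    rw [Measure.restrict_eq_zero.2 h0, lintegral_zero_measure] at h1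
    exact h2.ne' h1

/-- For fixed `y` in the preimage of `E'`, bounding J(x) by (1 + ε) J(y) in λ(E) = ∫ J gives λ(E) ≤
(1 + ε) J(y) λ(P ∩ T⁻¹E). Integrating over `y` turns J(y) into λ(E'). -/
lemma IsExpandingSystem.distortion_step {J : X → ℝ} (h : IsExpandingSystem lam T P0)
    (hJm : Measurable J) (hJpos : ∀ P ∈ P0, ∀ x ∈ P, 0 < J x)
    (hJ : ∀ P ∈ P0, ∀ A : Set X, MeasurableSet A → A ⊆ P →
      lam (T '' A) = ∫⁻ x in A, ENNReal.ofReal (J x) ∂lam)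
    {P Q : Set X} (hP : P ∈ P0) (hQP : Q ⊆ T '' P) {ε : ℝ} (hε : 0 ≤ ε)
    (hJε : ∀ x ∈ P ∩ T ⁻¹' Q, ∀ y ∈ P ∩ T ⁻¹' Q, |J x / J y - 1| ≤ ε)
    {E E' : Set X} (hE : MeasurableSet E) (hE' : MeasurableSet E') (hEQ : E ⊆ Q) (hEQ' : E' ⊆ Q) :
    lam E * lam (P ∩ T ⁻¹' E') ≤ ENNReal.ofReal (1 + ε) * lam (P ∩ T ⁻¹' E) * lam E' := by
  have hmE : MeasurableSet (P ∩ T ⁻¹' E) := (h.measurableSet_of_mem hP).inter (h.measurable_map hE)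
  have hmE' : MeasurableSet (P ∩ T ⁻¹' E') :=
    (h.measurableSet_of_mem hP).inter (h.measurable_map hE')
  have h1 : ∀ y ∈ P ∩ T ⁻¹' E',
      lam E ≤ ENNReal.ofReal (1 + ε) * lam (P ∩ T ⁻¹' E) * ENNReal.ofReal (J y) := by
    intro y hy
    rw [h.setLIntegral_jacobian hJ hP hE (hEQ.trans hQP)]
    calc ∫⁻ x in P ∩ T ⁻¹' E, ENNReal.ofReal (J x) ∂lam
        ≤ ∫⁻ x in P ∩ T ⁻¹' E, ENNReal.ofReal (1 + ε) * ENNReal.ofReal (J y) ∂lam := by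
          refine setLIntegral_mono measurable_const fun x hx => ?_
          rw [← ENNReal.ofReal_mul (by linarith)]
          refine ENNReal.ofReal_le_ofReal ?_
          have hy0 := hJpos P hP y hy.1
          have := (abs_le.1 (hJε x ⟨hx.1, hEQ hx.2⟩ y ⟨hy.1, hEQ' hy.2⟩)).2
          rw [sub_le_iff_le_add, div_le_iff₀ hy0] at this
          linarith
      _ = _ := by
          rw [setLIntegral_const]
          ring
  calc lam E * lam (P ∩ T ⁻¹' E') = ∫⁻ y in P ∩ T ⁻¹' E', lam E ∂lam := by
        rw [setLIntegral_const]
    _ ≤ ∫⁻ y in P ∩ T ⁻¹' E',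
          ENNReal.ofReal (1 + ε) * lam (P ∩ T ⁻¹' E) * ENNReal.ofReal (J y) ∂lam :=
        setLIntegral_mono (hJm.ennreal_ofReal.const_mul _) h1
    _ = _ := by
        rw [lintegral_const_mul _ hJm.ennreal_ofReal,
          ← h.setLIntegral_jacobian hJ hP hE' (hEQ'.trans hQP)]

/-- Bounded distortion. -/
lemma IsExpandingSystem.exists_distortion (h : IsExpandingSystem lam T P0) :
    ∃ K : ℝ≥0∞, K ≠ ⊤ ∧ ∀ n, ∀ B ∈ blocks T P0 n, ∃ R ∈ P0, B ⊆ T^[n] ⁻¹' R ∧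
      ∀ S S', MeasurableSet S → MeasurableSet S' → S ⊆ R → S' ⊆ R →
        lam (B ∩ T^[n] ⁻¹' S) * lam S' ≤ K * lam (B ∩ T^[n] ⁻¹' S') * lam S := by
  have := h.finite_measure
  obtain ⟨J, hJm, -, hJpos, hJ, α, C₁, hα, -, hC₁, hosc⟩ := h.jacobian
  obtain ⟨c, γ, hc, hγ0, hγ1, hdist⟩ := h.exists_dist_le
  set δ : ℝ := γ ^ α with hδ
  have hδ0 : 0 ≤ δ := Real.rpow_nonneg hγ0 _
  have hδ1 : δ < 1 := Real.rpow_lt_one hγ0 hγ1 hα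
  -- The image points lie in a block of level `n`, of diameter at most `c * γ ^ n`, so the Hölder
  -- condition yields a geometric, hence summable, error.
  set ε : ℕ → ℝ := fun n => C₁ * c ^ α * δ ^ n with hε
  have hε0 : ∀ n, 0 ≤ ε n := fun n => by positivity
  have hstep : ∀ n, ∀ P ∈ P0, ∀ Q ∈ blocks T P0 n, ∀ x ∈ P ∩ T ⁻¹' Q, ∀ y ∈ P ∩ T ⁻¹' Q,
      |J x / J y - 1| ≤ ε n := by
    intro n P hP Q hQ x hx y hy
    refine (hosc P hP x hx.1 y hy.1).trans ?_
    have h1 := hdist n Q hQ _ hx.2 _ hy.2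
    have h2 : dist (T x) (T y) ^ α ≤ (c * γ ^ n) ^ α := Real.rpow_le_rpow dist_nonneg h1 hα.le
    have h3 : (c * γ ^ n) ^ α = c ^ α * δ ^ n := by
      rw [Real.mul_rpow hc (by positivity), hδ, ← Real.rpow_natCast, ← Real.rpow_natCast,
        ← Real.rpow_mul hγ0, ← Real.rpow_mul hγ0, mul_comm α]
    rw [h3] at h2
    simp only [hε, mul_assoc]
    exact mul_le_mul_of_nonneg_left h2 hC₁.le
  have hmain : ∀ n, ∀ B ∈ blocks T P0 n, ∃ R ∈ P0, B ⊆ T^[n] ⁻¹' R ∧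
      ∀ S S', MeasurableSet S → MeasurableSet S' → S ⊆ R → S' ⊆ R →
        lam (B ∩ T^[n] ⁻¹' S) * lam S' ≤
          ENNReal.ofReal (∏ i ∈ Finset.range n, (1 + ε i)) * lam (B ∩ T^[n] ⁻¹' S') * lam S := by
    intro n
    induction n with
    | zero =>
      intro B hB
      refine ⟨B, hB, subset_rfl, fun S S' _ _ hS hS' => ?_⟩
      simp [Set.inter_eq_right.2 hS, Set.inter_eq_right.2 hS', mul_comm]
    | succ n ih =>
      rintro _ ⟨P, hP, Q, hQ, hQP, rfl⟩
      obtain ⟨R, hR, hQR, hS⟩ := ih Q hQ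
      refine ⟨R, hR, fun x hx => hQR hx.2, fun S S' hSm hSm' hSR hSR' => ?_⟩
      have hrew : ∀ S : Set X, P ∩ T ⁻¹' Q ∩ T^[n + 1] ⁻¹' S = P ∩ T ⁻¹' (Q ∩ T^[n] ⁻¹' S) := by
        intro S
        ext x
        simp [and_assoc]
      rw [hrew, hrew]
      have hQm := h.measurableSet_of_mem_blocks hQ
      have hE : MeasurableSet (Q ∩ T^[n] ⁻¹' S) := hQm.inter (h.measurable_map.iterate n hSm)
      have hE' : MeasurableSet (Q ∩ T^[n] ⁻¹' S') := hQm.inter (h.measurable_map.iterate n hSm')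
      have h1 := h.distortion_step hJm hJpos hJ hP hQP (hε0 n) (hstep n P hP Q hQ) hE' hE
        Set.inter_subset_left Set.inter_subset_left
      have h2 := hS S S' hSm hSm' hSR hSR'
      rw [Finset.prod_range_succ, ENNReal.ofReal_mul (Finset.prod_nonneg fun i _ => by
        have := hε0 i; linarith)]
      set a := lam (Q ∩ T^[n] ⁻¹' S)
      set a' := lam (Q ∩ T^[n] ⁻¹' S')
      set f := lam (P ∩ T ⁻¹' (Q ∩ T^[n] ⁻¹' S))
      set f' := lam (P ∩ T ⁻¹' (Q ∩ T^[n] ⁻¹' S'))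
      set p := ENNReal.ofReal (∏ i ∈ Finset.range n, (1 + ε i))
      set e := ENNReal.ofReal (1 + ε n)
      -- The two estimates are chained by cancelling `a'`. If `a'` vanishes, the induction
      -- hypothesis with `R` in place of `S` forces λ(S') = 0, since λ(Q) > 0.
      by_cases ha' : a' = 0
      · have hs' : lam S' = 0 := by
          have h3 := hS R S' (h.measurableSet_of_mem hR) hSm' subset_rfl hSR'
          have h4 : Q ∩ T^[n] ⁻¹' R = Q := Set.inter_eq_left.2 hQR
          have h5 : lam (Q ∩ T^[n] ⁻¹' S') = 0 := ha'
          rw [h4, h5, mul_zero, zero_mul, nonpos_iff_eq_zero, mul_eq_zero] at h3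
          exact h3.resolve_left (h.measure_block_pos hQ).ne'
        simp [hs']
      · have ha't : a' ≠ ⊤ := measure_ne_top _ _
        refine (ENNReal.mul_le_mul_iff_right ha' ha't).1 ?_
        calc a' * (f * lam S') = (a' * f) * lam S' := by ring
          _ ≤ (e * f' * a) * lam S' := by gcongr
          _ = e * f' * (a * lam S') := by ring
          _ ≤ e * f' * (p * a' * lam S) := by gcongr
          _ = a' * (p * e * f' * lam S) := by ring
  -- Uniformity in `n`: ∏ (1 + ε i) ≤ exp (∑ ε i), and the exponent is bounded by the geometric
  -- series.
  refine ⟨ENNReal.ofReal (Real.exp (C₁ * c ^ α * (1 - δ)⁻¹)), ENNReal.ofReal_ne_top, ?_⟩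
  intro n B hB
  obtain ⟨R, hR, hBR, hS⟩ := hmain n B hB
  refine ⟨R, hR, hBR, fun S S' h1 h2 h3 h4 => (hS S S' h1 h2 h3 h4).trans ?_⟩
  gcongr
  calc ∏ i ∈ Finset.range n, (1 + ε i) ≤ ∏ i ∈ Finset.range n, Real.exp (ε i) :=
        Finset.prod_le_prod (fun i _ => by have := hε0 i; linarith) fun i _ => by
          rw [add_comm]; exact Real.add_one_le_exp _
    _ = Real.exp (∑ i ∈ Finset.range n, ε i) := (Real.exp_sum _ _).symm
    _ ≤ _ := by
        refine Real.exp_le_exp.2 ?_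
        rw [← Finset.mul_sum]
        gcongr
        rw [← tsum_geometric_of_lt_one hδ0 hδ1]
        exact (summable_geometric_of_lt_one hδ0 hδ1).sum_le_tsum _ fun i _ => by positivity

end System

end ExpandingMaps

namespace ExpandingMaps

variable {X : Type*}

/-! ### Approximation of sets and densities by fine partitions. -/

section Approximation

/-- If the members of the families `C m` have diameters tending to `0`, then every measurable set
is approximated in measure by unions of members of `C m`. -/
lemma exists_approx_set [MetricSpace X] [MeasurableSpace X] [BorelSpace X] {ν : Measure X}
    [IsFiniteMeasure ν] {κ : ℕ → Type*} {C : ∀ m, κ m → Set X} {G : Set X} (hG : ν Gᶜ = 0)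
    (hcov : ∀ m, G ⊆ ⋃ b, C m b) {r : ℕ → ℝ} (hr : Tendsto r atTop (𝓝 0))
    (hdist : ∀ m b, ∀ x ∈ C m b, ∀ y ∈ C m b, dist x y ≤ r m)
    {A : Set X} (hA : MeasurableSet A) {ε : ℝ≥0∞} (hε : ε ≠ 0) :
    ∀ᶠ m in atTop, ∃ S : Set (κ m), ν (A \ ⋃ b ∈ S, C m b) ≤ ε ∧
      ν ((⋃ b ∈ S, C m b) \ A) ≤ ε := by
  obtain ⟨F, hFA, hF, hlt⟩ := hA.exists_isClosed_lt_add (measure_ne_top ν A) hε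
  have hε2 : ν F < ν F + ε := ENNReal.lt_add_right (measure_ne_top _ _) hε
  have h1 : Tendsto (fun m => ν (Metric.cthickening (r m) F)) atTop (𝓝 (ν F)) :=
    (tendsto_measure_cthickening_of_isClosed
      ⟨1, one_pos, measure_ne_top _ _⟩ hF).comp hr
  filter_upwards [h1.eventually_lt_const hε2] with m hm
  -- The pieces meeting the inner closed set `F` cover `F` up to a null set and stay inside its `r
  -- m`-thickening, whose measure tends to that of `F`.
  refine ⟨{b | (C m b ∩ F).Nonempty}, ?_, ?_⟩
  · have hsub : A \ ⋃ b ∈ {b | (C m b ∩ F).Nonempty}, C m b ⊆ (A \ F) ∪ Gᶜ := by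
      rintro x ⟨hxA, hx⟩
      by_cases hxG : x ∈ G
      · left
        refine ⟨hxA, fun hxF => hx ?_⟩
        obtain ⟨b, hb⟩ := Set.mem_iUnion.1 (hcov m hxG)
        exact Set.mem_biUnion (show b ∈ {b | (C m b ∩ F).Nonempty} from ⟨x, hb, hxF⟩) hb
      · exact Or.inr hxG
    calc _ ≤ ν (A \ F) + ν Gᶜ := (measure_mono hsub).trans (measure_union_le _ _)
      _ = ν (A \ F) := by rw [hG, add_zero]
      _ = ν A - ν F := measure_sdiff hFA hF.measurableSet.nullMeasurableSet (measure_ne_top _ _)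
      _ ≤ ε := by
        rw [tsub_le_iff_left]
        exact hlt.le
  · have hsub : (⋃ b ∈ {b | (C m b ∩ F).Nonempty}, C m b) \ A
        ⊆ Metric.cthickening (r m) F \ F := by
      rintro x ⟨hx, hxA⟩
      simp only [Set.mem_ofPred_eq, Set.mem_iUnion] at hx
      obtain ⟨b, ⟨y, hyb, hyF⟩, hxb⟩ := hx
      exact ⟨Metric.mem_cthickening_of_dist_le x y _ _ hyF (hdist m b x hxb y hyb),
        fun h => hxA (hFA h)⟩
    calc _ ≤ ν (Metric.cthickening (r m) F \ F) := measure_mono hsub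
      _ = ν (Metric.cthickening (r m) F) - ν F :=
        measure_sdiff (Metric.self_subset_cthickening F) hF.measurableSet.nullMeasurableSet
          (measure_ne_top _ _)
      _ ≤ ε := by
        rw [tsub_le_iff_left]
        exact hm.le

lemma exists_simpleFunc_le_lintegral_le_add [MeasurableSpace X] {ν : Measure X} {f : X → ℝ≥0∞}
    (hfin : ∫⁻ x, f x ∂ν ≠ ⊤) {ε : ℝ≥0∞} (hε : ε ≠ 0) :
    ∃ φ : SimpleFunc X ℝ≥0, (∀ x, (φ x : ℝ≥0∞) ≤ f x) ∧ ∫⁻ x, f x ∂ν ≤ ∫⁻ x, φ x ∂ν + ε := by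
  by_cases h0 : ∫⁻ x, f x ∂ν = 0
  · exact ⟨0, fun x => by simp, by simp [h0]⟩
  have h1 : ∫⁻ x, f x ∂ν - ε < ∫⁻ x, f x ∂ν := ENNReal.sub_lt_self hfin h0 hε
  nth_rewrite 2 [lintegral_eq_nnreal] at h1
  simp only [lt_iSup_iff] at h1
  obtain ⟨φ, hφ, hlt⟩ := h1
  refine ⟨φ, hφ, ?_⟩
  rw [← tsub_le_iff_right]
  refine hlt.le.trans (le_of_eq ?_)
  rw [← SimpleFunc.lintegral_eq_lintegral]
  rfl

/-- A function is approximated in `L¹` by functions constant on the members of `C m`, as soon as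
all measurable sets are approximated by unions of these members. -/
lemma exists_approx_fun [MeasurableSpace X] {ν : Measure X}
    [IsFiniteMeasure ν] {κ : ℕ → Type*} [∀ m, Finite (κ m)] {C : ∀ m, κ m → Set X}
    (hCm : ∀ m b, MeasurableSet (C m b)) (hCd : ∀ m, Pairwise fun b c => Disjoint (C m b) (C m c))
    (happ : ∀ A, MeasurableSet A → ∀ ε : ℝ≥0∞, ε ≠ 0 → ∀ᶠ m in atTop, ∃ S : Set (κ m),
      ν (A \ ⋃ b ∈ S, C m b) ≤ ε ∧ ν ((⋃ b ∈ S, C m b) \ A) ≤ ε)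
    {f : X → ℝ≥0∞} (hfin : ∫⁻ x, f x ∂ν ≠ ⊤) {ε : ℝ≥0∞} (hε : ε ≠ 0) :
    ∀ᶠ m in atTop, ∃ c : κ m → ℝ≥0∞, ∀ A, MeasurableSet A →
      ∫⁻ x in A, f x ∂ν ≤ ∑' b, c b * ν (C m b ∩ A) + ε ∧
      ∑' b, c b * ν (C m b ∩ A) ≤ ∫⁻ x in A, f x ∂ν + ε := by
  -- The coefficients are chosen before `A`: in the application `A` is a preimage under an iterate
  -- that depends on `m`.
  have hsimple : ∀ φ : SimpleFunc X ℝ≥0, ∀ ε : ℝ≥0∞, ε ≠ 0 →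
      ∀ᶠ m in atTop, ∃ c : κ m → ℝ≥0∞, ∀ A, MeasurableSet A →
        ∫⁻ x in A, φ x ∂ν ≤ ∑' b, c b * ν (C m b ∩ A) + ε ∧
        ∑' b, c b * ν (C m b ∩ A) ≤ ∫⁻ x in A, φ x ∂ν + ε := by
    intro φ
    induction φ using SimpleFunc.induction with
    | const a hs =>
      rename_i s
      intro ε hε
      -- For `a = 0` the tolerance is `⊤`, and `a * (ε / a) ≤ ε` still holds.
      filter_upwards [happ s hs (ε / a) (ENNReal.div_ne_zero.2 ⟨hε, ENNReal.coe_ne_top⟩)] with m hm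
      obtain ⟨S, hS1, hS2⟩ := hm
      classical
      refine ⟨fun b => if b ∈ S then a else 0, fun A hA => ?_⟩
      have h1 : ∑' b, (if b ∈ S then (a : ℝ≥0∞) else 0) * ν (C m b ∩ A)
          = a * ν ((⋃ b ∈ S, C m b) ∩ A) := by
        have : (⋃ b ∈ S, C m b) ∩ A = ⋃ b ∈ S, (C m b ∩ A) := by
          rw [Set.iUnion₂_inter]
        rw [this, measure_biUnion S.to_countable
          (fun b _ c _ hbc => (hCd m hbc).mono Set.inter_subset_left Set.inter_subset_left)
          (fun b _ => (hCm m b).inter hA), ← ENNReal.tsum_mul_left,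
          tsum_subtype S (fun b => (a : ℝ≥0∞) * ν (C m b ∩ A))]
        refine tsum_congr fun b => ?_
        by_cases hb : b ∈ S <;> simp [hb]
      have h2 : ∫⁻ x in A, (SimpleFunc.piecewise s hs (SimpleFunc.const X a)
          (SimpleFunc.const X 0) x : ℝ≥0∞) ∂ν = a * ν (s ∩ A) := by
        have : ∀ x, (SimpleFunc.piecewise s hs (SimpleFunc.const X a)
          (SimpleFunc.const X 0) x : ℝ≥0∞) = s.indicator (fun _ => (a : ℝ≥0∞)) x := by
          intro x
          by_cases hx : x ∈ s <;> simp [hx]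
        simp_rw [this]
        rw [lintegral_indicator hs, setLIntegral_const, Measure.restrict_apply hs]
      rw [h1, h2]
      have aux : ∀ E E' : Set X, ν (E \ E') ≤ ε / a → a * ν (E ∩ A) ≤ a * ν (E' ∩ A) + ε := by
        intro E E' h
        calc a * ν (E ∩ A) ≤ a * (ν (E' ∩ A) + ν (E \ E')) := by
              gcongr
              refine (measure_mono ?_).trans (measure_union_le _ _)
              rintro x ⟨hx, hxA⟩
              by_cases hx' : x ∈ E'
              · exact Or.inl ⟨hx', hxA⟩
              · exact Or.inr ⟨hx, hx'⟩
          _ ≤ a * ν (E' ∩ A) + a * (ε / a) := by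
              rw [mul_add]
              gcongr
          _ ≤ _ := by
              gcongr
              exact ENNReal.mul_div_le
      exact ⟨aux _ _ hS1, aux _ _ hS2⟩
    | add hd h1 h2 =>
      rename_i φ ψ
      intro ε hε
      have hε' : ε / 2 ≠ 0 := ENNReal.div_ne_zero.2 ⟨hε, by simp⟩
      filter_upwards [h1 _ hε', h2 _ hε'] with m hm1 hm2
      obtain ⟨c, hc⟩ := hm1
      obtain ⟨d, hd⟩ := hm2
      refine ⟨c + d, fun A hA => ?_⟩
      have h3 : ∫⁻ x in A, ((φ + ψ) x : ℝ≥0) ∂ν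
          = ∫⁻ x in A, φ x ∂ν + ∫⁻ x in A, ψ x ∂ν := by
        rw [← lintegral_add_left φ.measurable.coe_nnreal_ennreal]
        simp
      have h4 : ∑' b, (c + d) b * ν (C m b ∩ A)
          = ∑' b, c b * ν (C m b ∩ A) + ∑' b, d b * ν (C m b ∩ A) := by
        rw [← ENNReal.tsum_add]
        simp [add_mul]
      rw [h3, h4]
      obtain ⟨hc1, hc2⟩ := hc A hA
      obtain ⟨hd1, hd2⟩ := hd A hA
      constructor
      · refine (add_le_add hc1 hd1).trans (le_of_eq ?_)
        rw [add_add_add_comm, ENNReal.add_halves]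
      · refine (add_le_add hc2 hd2).trans (le_of_eq ?_)
        rw [add_add_add_comm, ENNReal.add_halves]
  have hε' : ε / 2 ≠ 0 := ENNReal.div_ne_zero.2 ⟨hε, by simp⟩
  obtain ⟨φ, hφ, hint⟩ := exists_simpleFunc_le_lintegral_le_add hfin hε'
  have hφm : Measurable fun x => (φ x : ℝ≥0∞) := φ.measurable.coe_nnreal_ennreal
  filter_upwards [hsimple φ _ hε'] with m hm
  obtain ⟨c, hc⟩ := hm
  refine ⟨c, fun A hA => ?_⟩
  obtain ⟨hc1, hc2⟩ := hc A hA
  constructor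
  · have h1 : ∫⁻ x in A, f x ∂ν = ∫⁻ x in A, φ x ∂ν + ∫⁻ x in A, (f x - φ x) ∂ν := by
      rw [← lintegral_add_left hφm]
      exact lintegral_congr fun x => (add_tsub_cancel_of_le (hφ x)).symm
    have h2 : ∫⁻ x in A, (f x - φ x) ∂ν ≤ ε / 2 := by
      refine (setLIntegral_le_lintegral _ _).trans ?_
      rw [lintegral_sub hφm (ne_top_of_le_ne_top hfin (lintegral_mono hφ)) (ae_of_all _ hφ)]
      exact tsub_le_iff_left.2 hint
    rw [h1]
    refine (add_le_add hc1 h2).trans (le_of_eq ?_)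
    rw [add_assoc, ENNReal.add_halves]
  · refine hc2.trans ?_
    gcongr
    · exact hφ _
    · exact ENNReal.half_le_self

end Approximation

/-! ### Comparability of the invariant and the reference measure. -/

section Comparability

variable [MetricSpace X] [MeasurableSpace X] [BorelSpace X] {lam μ : Measure X} {T : X → X}
  {P0 : Set (Set X)}

lemma IsACIPM.X0_compl_null (hμ : IsACIPM lam T μ) (h : IsExpandingSystem lam T P0) :
    μ (X0 T P0)ᶜ = 0 :=
  ExpandingMaps.X0_compl_null h.markov hμ.invariant.quasiMeasurePreserving
    (hμ.abs_cont h.compl_null)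

lemma IsExpandingSystem.exists_approx_cyl (h : IsExpandingSystem lam T P0) {ν : Measure X}
    [IsFiniteMeasure ν] (hν : ν (X0 T P0)ᶜ = 0) {A : Set X} (hA : MeasurableSet A) {ε : ℝ≥0∞}
    (hε : ε ≠ 0) :
    ∀ᶠ m in atTop, ∃ S : Set (Fin (m + 1) → P0),
      ν (A \ ⋃ b ∈ S, cyl T fun j => (b j : Set X)) ≤ ε ∧
      ν ((⋃ b ∈ S, cyl T fun j => (b j : Set X)) \ A) ≤ ε := by
  obtain ⟨c, γ, hc, hγ0, hγ1, hdist⟩ := h.exists_dist_le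
  refine exists_approx_set (C := fun m (b : Fin (m + 1) → P0) => cyl T fun j => (b j : Set X))
    hν (fun m x hx => Set.mem_iUnion.2 (exists_mem_cyl_of_mem_X0 hx (m + 1)))
    (r := fun m => c * γ ^ m) ?_ ?_ hA hε
  · simpa using (tendsto_pow_atTop_nhds_zero_of_lt_one hγ0 hγ1).const_mul c
  · intro m b x hx y hy
    exact hdist m _ (cyl_mem_blocks h.markov _ (fun j => (b j).2) ⟨x, hx⟩) x hx y hy

lemma IsExpandingSystem.measure_eq_tsum_inter {ν : Measure X} (h : IsExpandingSystem lam T P0) (hfin : P0.Finite)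
    (hν : ν ≪ lam) {S : Set X} (hS : MeasurableSet S) : ν S = ∑' P : P0, ν (P ∩ S) := by
  have := hfin.countable.to_subtype
  have h1 : ν S = ν (⋃ P : P0, (P : Set X) ∩ S) := by
    rw [← Set.iUnion_inter, ← Set.sUnion_eq_iUnion]
    refine measure_congr ?_
    have : ∀ᵐ x ∂ν, x ∈ ⋃₀ P0 := hν h.compl_null
    filter_upwards [this] with x hx
    exact propext ⟨fun hS => ⟨hx, hS⟩, fun hS => hS.2⟩
  rw [h1]
  have hd : ∀ P Q : P0, P ≠ Q → Disjoint (P : Set X) Q := fun P Q hPQ =>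
    Set.disjoint_iff_inter_eq_empty.2 (h.disjoint _ P.2 _ Q.2 fun hh => hPQ (Subtype.ext hh))
  exact measure_iUnion
    (fun P Q hPQ => (hd P Q hPQ).mono Set.inter_subset_left Set.inter_subset_left)
    fun P => (h.measurableSet_of_mem P.2).inter hS

/-- Bounded distortion with `S' = R`, the element of `P0` into which the block is mapped; finiteness
of `P0` bounds the resulting factor 1 / λ(R) uniformly. -/
lemma IsExpandingSystem.exists_measure_inter_preimage_le (h : IsExpandingSystem lam T P0)
    (hfin : P0.Finite) :
    ∃ C : ℝ≥0∞, C ≠ ⊤ ∧ ∀ n, ∀ B ∈ blocks T P0 n, ∀ S, MeasurableSet S →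
      lam (B ∩ T^[n] ⁻¹' S) ≤ C * lam B * lam S := by
  have := h.finite_measure
  have := hfin.fintype
  obtain ⟨K, hK, hD⟩ := h.exists_distortion
  refine ⟨K * ∑ R : P0, (lam R)⁻¹, ENNReal.mul_ne_top hK ?_, ?_⟩
  · exact ENNReal.sum_ne_top.2 fun R _ => ENNReal.inv_ne_top.2 (h.measure_pos R R.2).ne'
  intro n B hB S hS
  obtain ⟨R, hR, hBR, hdis⟩ := hD n B hB
  have hRm := h.measurableSet_of_mem hR
  have h1 := hdis (S ∩ R) R (hS.inter hRm) hRm Set.inter_subset_right subset_rfl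
  have h2 : B ∩ T^[n] ⁻¹' (S ∩ R) = B ∩ T^[n] ⁻¹' S := by
    ext x
    exact ⟨fun hx => ⟨hx.1, hx.2.1⟩, fun hx => ⟨hx.1, hx.2, hBR hx.1⟩⟩
  rw [h2, Set.inter_eq_left.2 hBR] at h1
  have h3 : (lam R)⁻¹ ≤ ∑ R : P0, (lam R)⁻¹ :=
    Finset.single_le_sum (f := fun R : P0 => (lam R)⁻¹) (fun _ _ => zero_le) (Finset.mem_univ ⟨R, hR⟩)
  have h0 : lam R ≠ 0 := (h.measure_pos R hR).ne'
  calc lam (B ∩ T^[n] ⁻¹' S) = lam (B ∩ T^[n] ⁻¹' S) * lam R * (lam R)⁻¹ := by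
        rw [mul_assoc, ENNReal.mul_inv_cancel h0 (measure_ne_top _ _), mul_one]
    _ ≤ K * lam B * lam S * ∑ R : P0, (lam R)⁻¹ := by
        refine mul_le_mul' (h1.trans ?_) h3
        gcongr
        exact Set.inter_subset_left
    _ = _ := by ring

/-- The `n`-th image of a block lies in one element `R` of `P0` only, so it may miss `S`; the
additional `n₀` iterates let `R` reach every element of `P0`. -/
lemma IsExpandingSystem.exists_measure_le_inter_preimage (h : IsExpandingSystem lam T P0)
    (hfin : P0.Finite) :
    ∃ C : ℝ≥0∞, C ≠ ⊤ ∧ ∃ n₀ : ℕ, ∀ n, ∀ B ∈ blocks T P0 n, ∀ S, MeasurableSet S →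
      lam B * lam S ≤ C * lam (B ∩ T^[n + n₀] ⁻¹' S) := by
  have := h.finite_measure
  have := hfin.fintype
  obtain ⟨K, hK, hD⟩ := h.exists_distortion
  obtain ⟨n₀, -, htrans⟩ := h.transitive
  have hX0 := ExpandingMaps.X0_compl_null h.markov (h.quasiMeasurePreserving hfin) h.compl_null
  -- A point of `X0` in R ∩ T^{-n₀}(P) lies in a block of level `n₀` inside `R` that is mapped into
  -- `P`; distortion on this block gives the constant.
  have h1 : ∀ R P : P0, ∃ c : ℝ≥0∞, c ≠ ⊤ ∧ ∀ S, MeasurableSet S → S ⊆ P →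
      lam S ≤ c * lam ((R : Set X) ∩ T^[n₀] ⁻¹' S) := by
    rintro ⟨R, hR⟩ ⟨P, hP⟩
    have h2 := htrans P hP R hR
    have h3 : ((T^[n₀] ⁻¹' P ∩ R) ∩ X0 T P0).Nonempty := by
      rw [Set.nonempty_iff_ne_empty]
      intro hemp
      refine h2.ne' (measure_mono_null (t := (X0 T P0)ᶜ) (fun x hx hx0 => ?_) hX0)
      exact (hemp ▸ Set.mem_inter hx hx0 : x ∈ (∅ : Set X))
    obtain ⟨x, ⟨hxP, hxR⟩, hx0⟩ := h3
    obtain ⟨B, hB, hxB⟩ := Set.mem_iInter.1 hx0 n₀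
    have huniq : ∀ {P Q : Set X} {y : X}, P ∈ P0 → Q ∈ P0 → y ∈ P → y ∈ Q → P = Q := by
      intro P Q y hP hQ hyP hyQ
      by_contra hne
      exact (h.disjoint P hP Q hQ hne ▸ Set.mem_inter hyP hyQ : y ∈ (∅ : Set X))
    obtain ⟨P', hP', hBP', hdis⟩ := hD n₀ B hB
    obtain rfl : P' = P := huniq hP' hP (hBP' hxB) hxP
    obtain ⟨R', hR', hBR'⟩ := exists_superset_of_mem_blocks hB
    obtain rfl : R' = R := huniq hR' hR (hBR' hxB) hxR
    have hB0 : lam B ≠ 0 := (h.measure_block_pos hB).ne'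
    refine ⟨(lam B)⁻¹ * K * lam P', by finiteness, fun S hS hSP => ?_⟩
    have hP'm := h.measurableSet_of_mem hP'
    have h4 := hdis P' S hP'm hS subset_rfl hSP
    rw [Set.inter_eq_left.2 hBP'] at h4
    calc lam S = (lam B)⁻¹ * (lam B * lam S) := by
          rw [← mul_assoc, ENNReal.inv_mul_cancel hB0 (measure_ne_top _ _), one_mul]
      _ ≤ (lam B)⁻¹ * (K * lam (R' ∩ T^[n₀] ⁻¹' S) * lam P') := by
          refine mul_le_mul' le_rfl (h4.trans ?_)
          gcongr
      _ = _ := by ring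
  choose c hc hcS using h1
  refine ⟨(∑ R : P0, ∑ P : P0, c R P) * K * lam Set.univ, ?_, n₀, ?_⟩
  · have : (∑ R : P0, ∑ P : P0, c R P) ≠ ⊤ :=
      ENNReal.sum_ne_top.2 fun R _ => ENNReal.sum_ne_top.2 fun P _ => hc R P
    finiteness
  intro n B hB S hS
  obtain ⟨R, hR, hBR, hdis⟩ := hD n B hB
  have hRm := h.measurableSet_of_mem hR
  have hmS : MeasurableSet (T^[n₀] ⁻¹' S) := h.measurable_map.iterate n₀ hS
  have h5 := hdis R (R ∩ T^[n₀] ⁻¹' S) hRm (hRm.inter hmS) subset_rfl Set.inter_subset_left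
  rw [Set.inter_eq_left.2 hBR] at h5
  have h6 : lam S ≤ (∑ R : P0, ∑ P : P0, c R P) * lam (R ∩ T^[n₀] ⁻¹' S) := by
    calc lam S = ∑ P : P0, lam (P ∩ S) := by
          rw [h.measure_eq_tsum_inter hfin Measure.AbsolutelyContinuous.rfl hS, tsum_fintype]
      _ ≤ ∑ P : P0, c ⟨R, hR⟩ P * lam (R ∩ T^[n₀] ⁻¹' S) := by
          refine Finset.sum_le_sum fun P _ => ?_
          refine (hcS ⟨R, hR⟩ P _ ((h.measurableSet_of_mem P.2).inter hS)
            Set.inter_subset_left).trans ?_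
          gcongr
          exact Set.inter_subset_right
      _ = (∑ P : P0, c ⟨R, hR⟩ P) * lam (R ∩ T^[n₀] ⁻¹' S) := by rw [Finset.sum_mul]
      _ ≤ _ := by
          refine mul_le_mul' ?_ le_rfl
          exact Finset.single_le_sum (f := fun R : P0 => ∑ P : P0, c R P) (fun _ _ => zero_le)
            (Finset.mem_univ (⟨R, hR⟩ : P0))
  have h7 : B ∩ T^[n] ⁻¹' (R ∩ T^[n₀] ⁻¹' S) ⊆ B ∩ T^[n + n₀] ⁻¹' S := by
    rintro x ⟨hx, -, hx2⟩
    refine ⟨hx, ?_⟩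
    rw [Set.mem_preimage, add_comm, Function.iterate_add_apply]
    exact hx2
  calc lam B * lam S ≤ lam B * ((∑ R : P0, ∑ P : P0, c R P) * lam (R ∩ T^[n₀] ⁻¹' S)) := by gcongr
    _ = (∑ R : P0, ∑ P : P0, c R P) * (lam B * lam (R ∩ T^[n₀] ⁻¹' S)) := by ring
    _ ≤ (∑ R : P0, ∑ P : P0, c R P) * (K * lam (B ∩ T^[n + n₀] ⁻¹' S) * lam Set.univ) := by
        refine mul_le_mul' le_rfl (h5.trans ?_)
        gcongr
        exact Set.subset_univ _
    _ = _ := by ring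

/-- The invariant measure is comparable with the reference measure. -/
lemma IsACIPM.exists_comparable (hμ : IsACIPM lam T μ) (h : IsExpandingSystem lam T P0)
    (hfin : P0.Finite) :
    ∃ C : ℝ≥0∞, C ≠ ⊤ ∧ ∀ S, MeasurableSet S → μ S ≤ C * lam S ∧ lam S ≤ C * μ S := by
  have := h.finite_measure
  have := hμ.probability
  have := hfin.to_subtype
  have hX0 := ExpandingMaps.X0_compl_null h.markov (h.quasiMeasurePreserving hfin) h.compl_null
  set f := μ.rnDeriv lam with hf
  have hμf : ∀ A, ∫⁻ x in A, f x ∂lam = μ A := fun A => by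
    rw [← withDensity_apply' f A, hf, Measure.withDensity_rnDeriv_eq _ _ hμ.abs_cont]
  have hfint : ∫⁻ x, f x ∂lam ≠ ⊤ := by
    rw [← setLIntegral_univ, hμf]; finiteness
  have happ := fun ε hε => exists_approx_fun (ν := lam)
    (C := fun m (b : Fin (m + 1) → P0) => cyl T fun j => (b j : Set X))
    (fun m b => measurableSet_cyl h.measurable_map fun j => h.measurableSet_of_mem (b j).2)
    (fun m b c hbc => disjoint_cyl h.disjoint hbc)
    (fun A hA ε hε => h.exists_approx_cyl hX0 hA hε) hfint (ε := ε) hε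
  simp only [hμf] at happ
  have hinv : ∀ n S, MeasurableSet S → μ (T^[n] ⁻¹' S) = μ S := fun n S hS =>
    (hμ.invariant.iterate n).measure_preimage hS.nullMeasurableSet
  have hcyl : ∀ m (b : Fin (m + 1) → P0), (cyl T fun j => (b j : Set X)) = ∅ ∨
      (cyl T fun j => (b j : Set X)) ∈ blocks T P0 m := by
    intro m b
    rcases Set.eq_empty_or_nonempty (cyl T fun j => (b j : Set X)) with h0 | h0
    · exact Or.inl h0
    · exact Or.inr (cyl_mem_blocks h.markov _ (fun j => (b j).2) h0)
  obtain ⟨C₁, hC₁, hup⟩ := h.exists_measure_inter_preimage_le hfin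
  obtain ⟨C₂, hC₂, n₀, hlow⟩ := h.exists_measure_le_inter_preimage hfin
  -- Removes the approximation error: the level `m` varies with `ε`, but the constants do not.
  have hlim : ∀ a b c : ℝ≥0∞, b ≠ ⊤ → (∀ ε : ℝ≥0∞, ε ≠ 0 → a ≤ c + b * ε) → a ≤ c := by
    intro a b c hb hε
    have h1 : Tendsto (fun ε : ℝ≥0∞ => c + b * ε) (𝓝[≠] 0) (𝓝 (c + b * 0)) :=
      (tendsto_const_nhds.add (ENNReal.Tendsto.const_mul tendsto_id (Or.inr hb))).mono_left
        nhdsWithin_le_nhds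
    rw [mul_zero, add_zero] at h1
    have : (𝓝[≠] (0 : ℝ≥0∞)).NeBot := by
      refine (inferInstance : (𝓝[>] (0 : ℝ≥0∞)).NeBot).mono (nhdsWithin_mono _ fun x hx => ?_)
      exact (ne_of_gt hx : x ≠ 0)
    exact ge_of_tendsto h1 (eventually_nhdsWithin_of_forall fun ε h0 => hε ε h0)
  refine ⟨C₁ + C₂, by finiteness, fun S hS => ⟨?_, ?_⟩⟩
  · refine le_trans ?_ (mul_le_mul_left (le_add_of_nonneg_right zero_le) _ : C₁ * lam S ≤ _)
    refine hlim _ (C₁ * lam S + 1) _ (by finiteness) fun ε hε => ?_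
    obtain ⟨m, c, hc⟩ := (happ ε hε).exists
    have h1 := (hc _ (h.measurable_map.iterate m hS)).1
    have h2 := (hc _ MeasurableSet.univ).2
    simp only [Set.inter_univ, measure_univ] at h2
    rw [hinv m S hS] at h1
    calc μ S ≤ _ := h1
      _ ≤ ∑' b : Fin (m + 1) → P0, c b * lam (cyl T fun j => (b j : Set X)) * (C₁ * lam S) + ε := by
          refine add_le_add (ENNReal.tsum_le_tsum fun b => ?_) le_rfl
          rw [mul_assoc]
          refine mul_le_mul' le_rfl ?_
          rcases hcyl m b with h0 | h0
          · simp [h0]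
          · exact (hup m _ h0 S hS).trans (le_of_eq (by ring))
      _ ≤ (1 + ε) * (C₁ * lam S) + ε := by
          rw [ENNReal.tsum_mul_right]
          gcongr
      _ = _ := by ring
  · refine le_trans ?_ (mul_le_mul_left (le_add_of_nonneg_left zero_le) _ : C₂ * μ S ≤ _)
    refine hlim _ (C₂ + lam S) _ (by finiteness) fun ε hε => ?_
    obtain ⟨m, c, hc⟩ := (happ ε hε).exists
    have h1 := (hc _ (h.measurable_map.iterate (m + n₀) hS)).2
    have h2 := (hc _ MeasurableSet.univ).1
    simp only [Set.inter_univ, measure_univ] at h2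
    rw [hinv _ S hS] at h1
    calc lam S = lam S * 1 := (mul_one _).symm
      _ ≤ lam S * (∑' b : Fin (m + 1) → P0, c b * lam (cyl T fun j => (b j : Set X)) + ε) := by
          gcongr
      _ = ∑' b : Fin (m + 1) → P0, c b * (lam (cyl T fun j => (b j : Set X)) * lam S)
            + lam S * ε := by
          rw [mul_add, ← ENNReal.tsum_mul_left]
          congr 1
          exact tsum_congr fun b => by ring
      _ ≤ ∑' b : Fin (m + 1) → P0, C₂ * (c b * lam ((cyl T fun j => (b j : Set X)) ∩
            T^[m + n₀] ⁻¹' S)) + lam S * ε := by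
          refine add_le_add (ENNReal.tsum_le_tsum fun b => ?_) le_rfl
          rw [mul_left_comm C₂]
          refine mul_le_mul' le_rfl ?_
          rcases hcyl m b with h0 | h0
          · simp [h0]
          · exact hlow m _ h0 S hS
      _ ≤ C₂ * (μ S + ε) + lam S * ε := by
          rw [ENNReal.tsum_mul_left]
          gcongr
      _ = _ := by ring

end Comparability
end ExpandingMaps

namespace ExpandingMaps

variable {X : Type*} [MeasurableSpace X] {μ : Measure X}

/-! ### Entropy of labellings and of their itineraries. -/

section Labels

/-- A labelling of the points by a set of labels, with measurable level sets. -/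
def IsLabelling {κ : Type*} (l : X → κ) : Prop := ∀ k, MeasurableSet (l ⁻¹' {k})

variable {ι κ : Type*}

lemma IsLabelling.measurableSet_preimage [Countable κ] {l : X → κ} (hl : IsLabelling l) (S : Set κ) :
    MeasurableSet (l ⁻¹' S) := by
  rw [← Set.biUnion_preimage_singleton]
  exact MeasurableSet.biUnion S.to_countable fun k _ => hl k

lemma IsLabelling.measurable_comp [Countable κ] {Y : Type*} [MeasurableSpace Y] {l : X → κ} (hl : IsLabelling l)
    (F : κ → Y) : Measurable fun x => F (l x) := fun S _ =>
  hl.measurableSet_preimage (F ⁻¹' S)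

lemma IsLabelling.lintegral_comp [Countable κ] {l : X → κ} (hl : IsLabelling l) (F : κ → ℝ≥0∞) :
    ∫⁻ x, F (l x) ∂μ = ∑' k, F k * μ (l ⁻¹' {k}) := by
  let : MeasurableSpace κ := ⊤
  have hlm : Measurable l := fun S _ => hl.measurableSet_preimage S
  rw [← lintegral_map (measurable_from_top (f := F)) hlm, lintegral_countable']
  exact tsum_congr fun k => by rw [Measure.map_apply hlm (hl k |> fun _ => trivial)]

lemma IsLabelling.prodMk {l : X → ι} {l' : X → κ} (hl : IsLabelling l) (hl' : IsLabelling l') :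
    IsLabelling fun x => (l x, l' x) := by
  rintro ⟨a, b⟩
  convert (hl a).inter (hl' b) using 1
  ext x
  simp

/-- The sequence of the labels of `x, T x, …, T^{n-1} x`. -/
def itinerary (T : X → X) (l : X → κ) (n : ℕ) (x : X) : Fin n → κ := fun j => l (T^[(j : ℕ)] x)

lemma IsLabelling.itinerary {T : X → X} (hT : Measurable T) {l : X → κ} (hl : IsLabelling l)
    (n : ℕ) : IsLabelling (itinerary T l n) := by
  intro a
  have : ExpandingMaps.itinerary T l n ⁻¹' {a} = ⋂ j : Fin n, T^[(j : ℕ)] ⁻¹' (l ⁻¹' {a j}) := by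
    ext x
    simp [ExpandingMaps.itinerary, funext_iff]
  rw [this]
  exact MeasurableSet.iInter fun j => hT.iterate _ (hl _)

/-- The entropy of a labelling. -/
noncomputable def labelEntropy (μ : Measure X) (l : X → κ) : ℝ≥0∞ :=
  ∑' k, ENNReal.ofReal (Real.negMulLog (μ.real (l ⁻¹' {k})))

lemma ofReal_real [IsFiniteMeasure μ] (A : Set X) : ENNReal.ofReal (μ.real A) = μ A :=
  ENNReal.ofReal_toReal (measure_ne_top _ _)

lemma negLog_mul_measure [IsFiniteMeasure μ] (y : ℝ) (A : Set X) :
    ENNReal.ofReal y * μ A = ENNReal.ofReal (μ.real A * y) := by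
  rw [ENNReal.ofReal_mul measureReal_nonneg, ofReal_real, mul_comm]

lemma labelEntropy_eq_lintegral [Countable κ] [IsFiniteMeasure μ] {l : X → κ} (hl : IsLabelling l) :
    labelEntropy μ l = ∫⁻ x, ENNReal.ofReal (-Real.log (μ.real (l ⁻¹' {l x}))) ∂μ := by
  rw [hl.lintegral_comp (fun k => ENNReal.ofReal (-Real.log (μ.real (l ⁻¹' {k}))))]
  refine tsum_congr fun k => ?_
  rw [negLog_mul_measure, Real.negMulLog]
  ring_nf

lemma IsLabelling.tsum_measure [Countable κ] [IsProbabilityMeasure μ] {l : X → κ} (hl : IsLabelling l) :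
    ∑' k, μ (l ⁻¹' {k}) = 1 := by
  have := hl.lintegral_comp (μ := μ) (fun _ => 1)
  simpa using this.symm

lemma labelEntropy_fst_le [Countable ι] [Countable κ] [IsFiniteMeasure μ] {l : X → ι} {l' : X → κ} (hl : IsLabelling l)
    (hl' : IsLabelling l') : labelEntropy μ l ≤ labelEntropy μ fun x => (l x, l' x) := by
  rw [labelEntropy_eq_lintegral hl, labelEntropy_eq_lintegral (hl.prodMk hl'),
    (hl.prodMk hl').lintegral_comp (fun k => ENNReal.ofReal (-Real.log (μ.real (l ⁻¹' {k.1})))),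
    (hl.prodMk hl').lintegral_comp (fun k => ENNReal.ofReal (-Real.log
      (μ.real ((fun x => (l x, l' x)) ⁻¹' {k}))))]
  refine ENNReal.tsum_le_tsum fun k => ?_
  by_cases h0 : μ ((fun x => (l x, l' x)) ⁻¹' {k}) = 0
  · simp [h0]
  gcongr
  · exact ENNReal.toReal_pos h0 (measure_ne_top _ _)
  · finiteness
  · rintro x rfl
    rfl

/-- Gibbs' inequality. -/
lemma labelEntropy_le_lintegral [Countable κ] [IsProbabilityMeasure μ] {l : X → κ} (hl : IsLabelling l)
    {q : κ → ℝ} (hq0 : ∀ k, 0 ≤ q k) (hq : ∑' k, ENNReal.ofReal (q k) ≤ 1)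
    (hpos : ∀ k, μ (l ⁻¹' {k}) ≠ 0 → q k ≠ 0) :
    labelEntropy μ l ≤ ∫⁻ x, ENNReal.ofReal (-Real.log (q (l x))) ∂μ := by
  -- Tangent-line inequality for the logarithm, with `p` moved to the left so that both sides are
  -- sums of nonnegative terms. After summation the total mass 1 cancels.
  have key : ∀ k, ENNReal.ofReal (Real.negMulLog (μ.real (l ⁻¹' {k}))) + μ (l ⁻¹' {k}) ≤
      ENNReal.ofReal (-Real.log (q k)) * μ (l ⁻¹' {k}) + ENNReal.ofReal (q k) := by
    intro k
    rw [negLog_mul_measure, ← ofReal_real]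
    by_cases h0 : μ (l ⁻¹' {k}) = 0
    · simp [measureReal_def, h0]
    have hp : 0 < μ.real (l ⁻¹' {k}) := ENNReal.toReal_pos h0 (measure_ne_top _ _)
    have hp1 : μ.real (l ⁻¹' {k}) ≤ 1 := measureReal_le_one
    have hqk : 0 < q k := lt_of_le_of_ne (hq0 k) (hpos k h0).symm
    set p := μ.real (l ⁻¹' {k})
    have hq1 : q k ≤ 1 := by
      have := (ENNReal.le_tsum k).trans hq
      rwa [ENNReal.ofReal_le_one] at this
    have h1 : Real.log (q k / p) ≤ q k / p - 1 := Real.log_le_sub_one_of_pos (by positivity)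
    rw [Real.log_div hqk.ne' hp.ne'] at h1
    have h2 : p * (Real.log (q k) - Real.log p) ≤ q k - p := by
      calc p * (Real.log (q k) - Real.log p) ≤ p * (q k / p - 1) := by gcongr
        _ = q k - p := by field_simp
    rw [← ENNReal.ofReal_add (Real.negMulLog_nonneg hp.le hp1) hp.le,
      ← ENNReal.ofReal_add (mul_nonneg hp.le (by simpa using Real.log_nonpos hqk.le hq1)) hqk.le]
    refine ENNReal.ofReal_le_ofReal ?_
    rw [Real.negMulLog]
    linarith
  have hsum := ENNReal.tsum_le_tsum key
  rw [ENNReal.tsum_add, ENNReal.tsum_add, hl.tsum_measure] at hsum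
  rw [hl.lintegral_comp (fun k => ENNReal.ofReal (-Real.log (q k)))]
  exact (ENNReal.add_le_add_iff_right ENNReal.one_ne_top).1 (hsum.trans (by gcongr))

lemma labelEntropy_le_log_card [IsProbabilityMeasure μ] {κ : Type*} [Fintype κ] [Nonempty κ]
    {l : X → κ} (hl : IsLabelling l) :
    labelEntropy μ l ≤ ENNReal.ofReal (Real.log (Fintype.card κ)) := by
  have hc : (0 : ℝ) < Fintype.card κ := by exact_mod_cast Fintype.card_pos
  refine (labelEntropy_le_lintegral hl (q := fun _ => (Fintype.card κ : ℝ)⁻¹)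
    (fun _ => by positivity) ?_ (fun _ _ => by positivity)).trans ?_
  · rw [tsum_fintype, Finset.sum_const, Finset.card_univ, nsmul_eq_mul,
      ENNReal.ofReal_inv_of_pos hc, ENNReal.ofReal_natCast]
    exact ENNReal.mul_inv_le_one _
  · simp

lemma tsum_pi_prod_le {n : ℕ} (f : Fin n → ι → ℝ≥0∞) :
    ∑' a : Fin n → ι, ∏ j, f j (a j) ≤ ∏ j, ∑' i, f j i := by
  induction n with
  | zero => simp
  | succ n ih =>
    rw [← (Fin.consEquiv fun _ => ι).tsum_eq, ENNReal.tsum_prod', Fin.prod_univ_succ,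
      ← ENNReal.tsum_mul_right]
    refine ENNReal.tsum_le_tsum fun i => ?_
    simp only [Fin.consEquiv_apply, Fin.prod_univ_succ, Fin.cons_zero, Fin.cons_succ]
    rw [ENNReal.tsum_mul_left]
    gcongr
    exact ih fun j => f j.succ

/-- No positivity is required: `Real.log 0 = 0`, so the left side is zero when a factor vanishes. -/
lemma ofReal_neg_log_mul_le (a b : ℝ) : ENNReal.ofReal (-Real.log (a * b)) ≤
    ENNReal.ofReal (-Real.log a) + ENNReal.ofReal (-Real.log b) := by
  rcases eq_or_ne a 0 with rfl | ha
  · simp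
  rcases eq_or_ne b 0 with rfl | hb
  · simp
  rw [Real.log_mul ha hb, neg_add]
  exact ENNReal.ofReal_add_le

lemma ofReal_neg_log_prod_le {α : Type*} (s : Finset α) (f : α → ℝ) :
    ENNReal.ofReal (-Real.log (∏ j ∈ s, f j)) ≤ ∑ j ∈ s, ENNReal.ofReal (-Real.log (f j)) := by
  classical
  induction s using Finset.induction_on with
  | empty => simp
  | insert a s ha ih =>
    rw [Finset.prod_insert ha, Finset.sum_insert ha]
    exact (ofReal_neg_log_mul_le _ _).trans (by gcongr)

/-- The conditional probability of the label `a` of `l` given the label `b` of `l'`. -/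
noncomputable def condProb (μ : Measure X) (l : X → ι) (l' : X → κ) (a : ι) (b : κ) : ℝ :=
  μ.real (l ⁻¹' {a} ∩ l' ⁻¹' {b}) / μ.real (l' ⁻¹' {b})

lemma condProb_nonneg (l : X → ι) (l' : X → κ) (a : ι) (b : κ) : 0 ≤ condProb μ l l' a b :=
  div_nonneg measureReal_nonneg measureReal_nonneg

lemma measureReal_mul_condProb [IsFiniteMeasure μ] (l : X → ι) (l' : X → κ) (a : ι) (b : κ) :
    μ.real (l' ⁻¹' {b}) * condProb μ l l' a b = μ.real (l ⁻¹' {a} ∩ l' ⁻¹' {b}) := by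
  by_cases h : μ.real (l' ⁻¹' {b}) = 0
  · rw [h, zero_mul]
    exact (le_antisymm (h ▸ measureReal_mono Set.inter_subset_right) measureReal_nonneg).symm
  · rw [condProb, mul_div_cancel₀ _ h]

lemma tsum_condProb_le_one [Countable ι] [IsFiniteMeasure μ] {l : X → ι} {l' : X → κ} (hl : IsLabelling l)
    (hl' : IsLabelling l') (b : κ) : ∑' a, ENNReal.ofReal (condProb μ l l' a b) ≤ 1 := by
  by_cases h : μ (l' ⁻¹' {b}) = 0
  · simp [condProb, measureReal_def, h]
  have h1 : ∀ a, ENNReal.ofReal (condProb μ l l' a b)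
      = μ (l ⁻¹' {a} ∩ l' ⁻¹' {b}) * (μ (l' ⁻¹' {b}))⁻¹ := fun a => by
    rw [condProb, ENNReal.ofReal_div_of_pos (show 0 < μ.real _ from ENNReal.toReal_pos h (measure_ne_top _ _)),
      ofReal_real, ofReal_real, div_eq_mul_inv]
  simp_rw [h1]
  rw [ENNReal.tsum_mul_right, ← measure_iUnion
    (fun a c hac => Set.disjoint_left.2 fun x hx hy => hac (hx.1.symm.trans hy.1))
    (fun a => (hl a).inter (hl' b)), ← div_eq_mul_inv]
  refine ENNReal.div_le_of_le_mul ?_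
  rw [one_mul]
  exact measure_mono (Set.iUnion_subset fun a => Set.inter_subset_right)

/-- The conditional entropy of the labelling `l` given the labelling `l'`. -/
noncomputable def condEntropy (μ : Measure X) (l : X → ι) (l' : X → κ) : ℝ≥0∞ :=
  ∫⁻ x, ENNReal.ofReal (-Real.log (condProb μ l l' (l x) (l' x))) ∂μ

/-- Gibbs' inequality replaces the chain rule. The trial distribution `q` treats the letters of the
`l`-word as conditionally independent given the `l'`-word, the `j`-th letter seeing only the window
of length `m` that starts at `j`. Then -log q splits into a sum, and invariance makes each
conditional term equal to the same conditional entropy. -/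
lemma labelEntropy_itinerary_le [Countable ι] [Countable κ] [IsProbabilityMeasure μ] {T : X → X} (hT : MeasurePreserving T μ μ)
    {l : X → ι} {l' : X → κ} (hl : IsLabelling l) (hl' : IsLabelling l') (n m : ℕ) :
    labelEntropy μ (itinerary T l n) ≤
      labelEntropy μ (itinerary T l' (n + m)) + n * condEntropy μ l (itinerary T l' m) := by
  have hln := hl.itinerary hT.measurable n
  have hlm := hl'.itinerary hT.measurable m
  have hlnm := hl'.itinerary hT.measurable (n + m)
  refine (labelEntropy_fst_le hln hlnm).trans ?_
  -- The window of length `m` at position `j`; the last one needs the `l'`-word to have length at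
  -- least n + m - 1.
  let σ : Fin n → (Fin (n + m) → κ) → (Fin m → κ) :=
    fun j b i => b ⟨j + i, by omega⟩
  have hσ : ∀ j x, σ j (itinerary T l' (n + m) x) = itinerary T l' m (T^[(j : ℕ)] x) := by
    intro j x
    funext i
    simp only [σ, itinerary]
    rw [add_comm, Function.iterate_add_apply]
  let q : (Fin n → ι) × (Fin (n + m) → κ) → ℝ := fun k =>
    μ.real (itinerary T l' (n + m) ⁻¹' {k.2}) *
      ∏ j, condProb μ l (itinerary T l' m) (k.1 j) (σ j k.2)
  refine (labelEntropy_le_lintegral (q := q) (hln.prodMk hlnm) ?_ ?_ ?_).trans ?_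
  · exact fun k => mul_nonneg measureReal_nonneg (Finset.prod_nonneg fun j _ =>
      condProb_nonneg _ _ _ _)
  · rw [ENNReal.tsum_prod', ENNReal.tsum_comm]
    calc ∑' (b : Fin (n + m) → κ) (a : Fin n → ι), ENNReal.ofReal (q (a, b))
        ≤ ∑' b : Fin (n + m) → κ, μ (itinerary T l' (n + m) ⁻¹' {b}) := by
          refine ENNReal.tsum_le_tsum fun b => ?_
          have h1 : ∀ a, ENNReal.ofReal (q (a, b)) = μ (itinerary T l' (n + m) ⁻¹' {b}) *
              ∏ j, ENNReal.ofReal (condProb μ l (itinerary T l' m) (a j) (σ j b)) := by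
            intro a
            rw [ENNReal.ofReal_mul measureReal_nonneg, ofReal_real,
              ENNReal.ofReal_prod_of_nonneg fun j _ => condProb_nonneg _ _ _ _]
          simp_rw [h1]
          rw [ENNReal.tsum_mul_left]
          refine mul_le_of_le_one_right' ?_
          refine (tsum_pi_prod_le fun j i => ENNReal.ofReal
            (condProb μ l (itinerary T l' m) i (σ j b))).trans (Finset.prod_le_one' fun j _ => ?_)
          exact tsum_condProb_le_one hl hlm (σ j b)
      _ ≤ 1 := hlnm.tsum_measure.le
  · rintro ⟨a, b⟩ hk
    refine mul_ne_zero ?_ (Finset.prod_ne_zero_iff.2 fun j _ => ?_)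
    · refine (ENNReal.toReal_pos (fun h0 => hk (measure_mono_null ?_ h0)) (measure_ne_top _ _)).ne'
      intro x hx
      exact congrArg Prod.snd hx
    · have h2 : μ (l ⁻¹' {a j} ∩ itinerary T l' m ⁻¹' {σ j b}) ≠ 0 := by
        rw [← (hT.iterate j).measure_preimage ((hl _).inter (hlm _)).nullMeasurableSet]
        refine fun h0 => hk (measure_mono_null ?_ h0)
        rintro x hx
        have hx1 : itinerary T l n x = a := congrArg Prod.fst hx
        have hx2 : itinerary T l' (n + m) x = b := congrArg Prod.snd hx
        refine ⟨congrFun hx1 j, ?_⟩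
        change itinerary T l' m (T^[(j : ℕ)] x) = σ j b
        rw [← hσ, hx2]
      have h3 : μ (itinerary T l' m ⁻¹' {σ j b}) ≠ 0 := fun h0 =>
        h2 (measure_mono_null Set.inter_subset_right h0)
      exact div_ne_zero (ENNReal.toReal_ne_zero.2 ⟨h2, measure_ne_top _ _⟩)
        (ENNReal.toReal_ne_zero.2 ⟨h3, measure_ne_top _ _⟩)
  · have hmeas1 : Measurable fun x => ENNReal.ofReal
        (-Real.log (μ.real (itinerary T l' (n + m) ⁻¹' {itinerary T l' (n + m) x}))) :=
      hlnm.measurable_comp fun b =>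
        ENNReal.ofReal (-Real.log (μ.real (itinerary T l' (n + m) ⁻¹' {b})))
    have hmeas2 : Measurable fun x => ENNReal.ofReal
        (-Real.log (condProb μ l (itinerary T l' m) (l x) (itinerary T l' m x))) :=
      (hl.prodMk hlm).measurable_comp fun k => ENNReal.ofReal
        (-Real.log (condProb μ l (itinerary T l' m) k.1 k.2))
    calc ∫⁻ x, ENNReal.ofReal (-Real.log (q (itinerary T l n x, itinerary T l' (n + m) x))) ∂μ
        ≤ ∫⁻ x, (ENNReal.ofReal
            (-Real.log (μ.real (itinerary T l' (n + m) ⁻¹' {itinerary T l' (n + m) x}))) +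
            ∑ j : Fin n, ENNReal.ofReal (-Real.log (condProb μ l (itinerary T l' m)
              (l (T^[(j : ℕ)] x)) (itinerary T l' m (T^[(j : ℕ)] x))))) ∂μ := by
          refine lintegral_mono fun x => ?_
          refine (ofReal_neg_log_mul_le _ _).trans ?_
          refine add_le_add le_rfl ((ofReal_neg_log_prod_le _ _).trans (le_of_eq ?_))
          simp only [hσ]
          rfl
      _ = _ := by
          rw [lintegral_add_left hmeas1, ← labelEntropy_eq_lintegral hlnm,
            lintegral_finsetSum]
          swap
          · exact fun j _ => hmeas2.comp (hT.measurable.iterate j)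
          congr 1
          have : ∀ j : Fin n, ∫⁻ x, ENNReal.ofReal (-Real.log (condProb μ l (itinerary T l' m)
              (l (T^[(j : ℕ)] x)) (itinerary T l' m (T^[(j : ℕ)] x)))) ∂μ
              = condEntropy μ l (itinerary T l' m) := fun j =>
            (hT.iterate j).lintegral_comp hmeas2
          simp [this]

end Labels
end ExpandingMaps

namespace ExpandingMaps

variable {X : Type*} [MeasurableSpace X] {μ : Measure X}

/-! ### Vanishing of conditional entropy and the generator inequality. -/

section Generator

variable {ι κ : Type*}

lemma IsLabelling.sum_measureReal_inter [IsFiniteMeasure μ] {l : X → κ}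
    (hl : IsLabelling l) {A : Set X} (hA : MeasurableSet A) (s : Finset κ) :
    ∑ b ∈ s, μ.real (A ∩ l ⁻¹' {b}) = μ.real (A ∩ l ⁻¹' s) := by
  rw [← measureReal_biUnion_finset
    (fun b _ c _ hbc => Set.disjoint_left.2 fun x hx hy => hbc (hx.2.symm.trans hy.2))
    fun b _ => hA.inter (hl b)]
  congr 1
  ext x
  simp

lemma condProb_le_one [IsFiniteMeasure μ] (l : X → ι) (l' : X → κ) (a : ι) (b : κ) :
    condProb μ l l' a b ≤ 1 :=
  div_le_one_of_le₀ (measureReal_mono Set.inter_subset_right) measureReal_nonneg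

/-- The contribution of the label `a` to the conditional entropy of `l` given `l'`. -/
noncomputable def condTerm [Fintype κ] (μ : Measure X) (l : X → ι) (l' : X → κ) (a : ι) : ℝ :=
  ∑ b, μ.real (l ⁻¹' {a} ∩ l' ⁻¹' {b}) * -Real.log (condProb μ l l' a b)

lemma condEntropy_eq_tsum [Countable ι] [Fintype κ] [IsFiniteMeasure μ] {l : X → ι} {l' : X → κ}
    (hl : IsLabelling l) (hl' : IsLabelling l') :
    condEntropy μ l l' = ∑' a, ENNReal.ofReal (condTerm μ l l' a) := by
  rw [condEntropy, (hl.prodMk hl').lintegral_comp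
    (fun k => ENNReal.ofReal (-Real.log (condProb μ l l' k.1 k.2))), ENNReal.tsum_prod']
  refine tsum_congr fun a => ?_
  rw [tsum_fintype, condTerm, ENNReal.ofReal_sum_of_nonneg fun b _ => mul_nonneg measureReal_nonneg
    (by simpa using Real.log_nonpos (condProb_nonneg l l' a b) (condProb_le_one l l' a b))]
  refine Finset.sum_congr rfl fun b _ => ?_
  rw [negLog_mul_measure]
  congr 3
  ext x
  simp

/-- Tangent-line bound r (log t - log r) ≤ t - r, scaled by the mass of the condition. The free
parameter `t` takes three values later: the mass of the label, 1, and a small number. -/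
lemma measureReal_mul_neg_log_le [IsFiniteMeasure μ] (l : X → ι) (l' : X → κ) (a : ι) (b : κ)
    {t : ℝ} (ht : 0 < t) :
    μ.real (l ⁻¹' {a} ∩ l' ⁻¹' {b}) * -Real.log (condProb μ l l' a b) ≤
      μ.real (l ⁻¹' {a} ∩ l' ⁻¹' {b}) * -Real.log t + t * μ.real (l' ⁻¹' {b})
        - μ.real (l ⁻¹' {a} ∩ l' ⁻¹' {b}) := by
  rw [← measureReal_mul_condProb l l' a b]
  have hb : 0 ≤ μ.real (l' ⁻¹' {b}) := measureReal_nonneg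
  rcases (condProb_nonneg (μ := μ) l l' a b).eq_or_lt with h0 | h0
  · rw [← h0]
    simpa using mul_nonneg ht.le hb
  set r := condProb μ l l' a b
  have h1 : Real.log (t / r) ≤ t / r - 1 := Real.log_le_sub_one_of_pos (by positivity)
  rw [Real.log_div ht.ne' h0.ne'] at h1
  have h2 : r * (Real.log t - Real.log r) ≤ t - r := by
    calc r * (Real.log t - Real.log r) ≤ r * (t / r - 1) := by gcongr
      _ = t - r := by field_simp
  nlinarith [mul_le_mul_of_nonneg_left h2 hb]

lemma condTerm_le_negMulLog [Fintype κ] [IsProbabilityMeasure μ] {l : X → ι} {l' : X → κ}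
    (hl : IsLabelling l) (hl' : IsLabelling l') (a : ι) :
    condTerm μ l l' a ≤ Real.negMulLog (μ.real (l ⁻¹' {a})) := by
  have h1 := hl'.sum_measureReal_inter (μ := μ) (hl a) Finset.univ
  have h2 := hl'.sum_measureReal_inter (μ := μ) MeasurableSet.univ Finset.univ
  simp only [Finset.coe_univ, Set.preimage_univ, Set.inter_univ, Set.univ_inter, probReal_univ]
    at h1 h2
  rcases (measureReal_nonneg (μ := μ) (s := l ⁻¹' {a})).eq_or_lt with h0 | h0
  · have h3 : ∀ b, μ.real (l ⁻¹' {a} ∩ l' ⁻¹' {b}) = 0 := fun b =>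
      le_antisymm (h0 ▸ measureReal_mono Set.inter_subset_left) measureReal_nonneg
    rw [← h0]
    simp [condTerm, h3]
  · refine (Finset.sum_le_sum fun b _ => measureReal_mul_neg_log_le l l' a b h0).trans ?_
    rw [Finset.sum_sub_distrib, Finset.sum_add_distrib, ← Finset.sum_mul, ← Finset.mul_sum, h1, h2,
      Real.negMulLog]
    linarith

/-- The union of the labels in `s` plays the role of an approximation of the level set of `a`. On
`s` the bound with parameter 1 leaves only the excess of that union; off `s` the joint mass is small
and pays the factor -log t. -/
lemma condTerm_le_of_approx [Fintype κ] [IsProbabilityMeasure μ] {l : X → ι} {l' : X → κ}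
    (hl : IsLabelling l) (hl' : IsLabelling l') (a : ι) (s : Finset κ) {t : ℝ} (ht : 0 < t) :
    condTerm μ l l' a ≤ μ.real (l' ⁻¹' s \ l ⁻¹' {a}) +
      μ.real (l ⁻¹' {a} \ l' ⁻¹' s) * -Real.log t + t := by
  classical
  have hsm : MeasurableSet (l' ⁻¹' s) := hl'.measurableSet_preimage s
  have h1 := hl'.sum_measureReal_inter (μ := μ) (hl a) s
  have h2 := hl'.sum_measureReal_inter (μ := μ) (hl a) sᶜ
  have h3 := hl'.sum_measureReal_inter (μ := μ) MeasurableSet.univ s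
  have h4 := hl'.sum_measureReal_inter (μ := μ) MeasurableSet.univ sᶜ
  simp only [Set.univ_inter, Finset.coe_compl, Set.preimage_compl, ← Set.sdiff_eq] at h1 h2 h3 h4
  have h5 : ∑ b ∈ s, μ.real (l ⁻¹' {a} ∩ l' ⁻¹' {b}) * -Real.log (condProb μ l l' a b) ≤
      μ.real (l' ⁻¹' s \ l ⁻¹' {a}) := by
    refine (Finset.sum_le_sum fun b _ => measureReal_mul_neg_log_le l l' a b one_pos).trans ?_
    rw [Finset.sum_sub_distrib, Finset.sum_add_distrib, ← Finset.sum_mul, ← Finset.mul_sum, h1, h3]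
    have := measureReal_sdiff_add_inter (μ := μ) (s := l' ⁻¹' s) (hl a)
    rw [Set.inter_comm] at this
    simp
    linarith
  have h6 : ∑ b ∈ sᶜ, μ.real (l ⁻¹' {a} ∩ l' ⁻¹' {b}) * -Real.log (condProb μ l l' a b) ≤
      μ.real (l ⁻¹' {a} \ l' ⁻¹' s) * -Real.log t + t := by
    refine (Finset.sum_le_sum fun b _ => measureReal_mul_neg_log_le l l' a b ht).trans ?_
    rw [Finset.sum_sub_distrib, Finset.sum_add_distrib, ← Finset.sum_mul, ← Finset.mul_sum, h2, h4]
    have h7 : t * μ.real (Set.univ \ l' ⁻¹' s) ≤ t * 1 := by gcongr; exact measureReal_le_one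
    have h8 : 0 ≤ μ.real (l ⁻¹' {a} \ l' ⁻¹' s) := measureReal_nonneg
    linarith
  rw [condTerm, ← Finset.sum_add_sum_compl s]
  linarith

lemma tendsto_condTerm [IsProbabilityMeasure μ] {κ : ℕ → Type*} [∀ m, Fintype (κ m)]
    {l : X → ι} {L : ∀ m, X → κ m} (hl : IsLabelling l) (hL : ∀ m, IsLabelling (L m))
    (happ : ∀ A, MeasurableSet A → ∀ ε : ℝ≥0∞, ε ≠ 0 → ∀ᶠ m in atTop, ∃ S : Set (κ m),
      μ (A \ L m ⁻¹' S) ≤ ε ∧ μ (L m ⁻¹' S \ A) ≤ ε) (a : ι) :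
    Tendsto (fun m => ENNReal.ofReal (condTerm μ l (L m) a)) atTop (𝓝 0) := by
  rw [ENNReal.tendsto_nhds_zero]
  intro ε hε
  by_cases hεt : ε = ⊤
  · simp [hεt]
  obtain ⟨e, he, rfl⟩ : ∃ e : ℝ, 0 < e ∧ ε = ENNReal.ofReal e :=
    ⟨ε.toReal, ENNReal.toReal_pos hε.ne' hεt, (ENNReal.ofReal_toReal hεt).symm⟩
  -- `t` is fixed before the tolerance `δ`, because `δ` has to absorb the factor -log t; each of the
  -- three error terms gets e / 3.
  set t : ℝ := min (e / 3) 1 with ht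
  have ht0 : 0 < t := by positivity
  have hlog : 0 ≤ -Real.log t := by
    simpa using Real.log_nonpos ht0.le (min_le_right _ _)
  set δ : ℝ := min (e / 3) (e / 3 / (1 + -Real.log t)) with hδ
  have hδ0 : 0 < δ := by positivity
  filter_upwards [happ _ (hl a) (ENNReal.ofReal δ) (by simpa using hδ0)] with m hm
  obtain ⟨S, hS1, hS2⟩ := hm
  classical
  have h1 := condTerm_le_of_approx (μ := μ) hl (hL m) a S.toFinset ht0
  rw [Set.coe_toFinset] at h1
  have h2 : μ.real (l ⁻¹' {a} \ L m ⁻¹' S) ≤ δ := ENNReal.toReal_le_of_le_ofReal hδ0.le hS1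
  have h3 : μ.real (L m ⁻¹' S \ l ⁻¹' {a}) ≤ δ := ENNReal.toReal_le_of_le_ofReal hδ0.le hS2
  refine ENNReal.ofReal_le_ofReal (h1.trans ?_)
  have h4 : μ.real (l ⁻¹' {a} \ L m ⁻¹' S) * -Real.log t ≤ e / 3 := by
    calc _ ≤ (e / 3 / (1 + -Real.log t)) * (1 + -Real.log t) := by
          refine mul_le_mul (h2.trans (min_le_right _ _)) (by linarith) hlog (by positivity)
      _ = e / 3 := by field_simp
  have h5 : δ ≤ e / 3 := min_le_left _ _
  have h6 : t ≤ e / 3 := min_le_left _ _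
  linarith

/-- Dominated convergence for the counting measure on the labels: each term tends to zero and is
dominated by the corresponding summand of the finite entropy of `l`. -/
lemma tendsto_condEntropy [Countable ι] [IsProbabilityMeasure μ] {κ : ℕ → Type*}
    [∀ m, Fintype (κ m)] {l : X → ι} {L : ∀ m, X → κ m} (hl : IsLabelling l)
    (hL : ∀ m, IsLabelling (L m))
    (happ : ∀ A, MeasurableSet A → ∀ ε : ℝ≥0∞, ε ≠ 0 → ∀ᶠ m in atTop, ∃ S : Set (κ m),
      μ (A \ L m ⁻¹' S) ≤ ε ∧ μ (L m ⁻¹' S \ A) ≤ ε) (hH : labelEntropy μ l ≠ ⊤) :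
    Tendsto (fun m => condEntropy μ l (L m)) atTop (𝓝 0) := by
  let : MeasurableSpace ι := ⊤
  have h1 : ∀ m, condEntropy μ l (L m)
      = ∫⁻ a, ENNReal.ofReal (condTerm μ l (L m) a) ∂Measure.count := fun m => by
    rw [lintegral_count, condEntropy_eq_tsum hl (hL m)]
  simp_rw [h1]
  have h2 := tendsto_lintegral_of_dominated_convergence (μ := Measure.count)
    (F := fun m a => ENNReal.ofReal (condTerm μ l (L m) a)) (f := fun _ => 0)
    (fun a => ENNReal.ofReal (Real.negMulLog (μ.real (l ⁻¹' {a}))))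
    (fun m => measurable_from_top)
    (fun m => ae_of_all _ fun a => ENNReal.ofReal_le_ofReal (condTerm_le_negMulLog hl (hL m) a))
    (by rw [lintegral_count]; exact hH)
    (ae_of_all _ fun a => tendsto_condTerm hl hL happ a)
  simpa using h2

/-- Kolmogorov–Sinai inequality: with `m` fixed, the m + 1 extra letters are negligible after
division by `n`; then `m` tends to infinity and the conditional entropy disappears. -/
lemma limsup_labelEntropy_itinerary_le [Countable ι] [Fintype κ] [IsProbabilityMeasure μ]
    {T : X → X}
    (hT : MeasurePreserving T μ μ) {l : X → ι} {p : X → κ} (hl : IsLabelling l)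
    (hp : IsLabelling p)
    (happ : ∀ A, MeasurableSet A → ∀ ε : ℝ≥0∞, ε ≠ 0 → ∀ᶠ m in atTop,
      ∃ S : Set (Fin (m + 1) → κ),
        μ (A \ itinerary T p (m + 1) ⁻¹' S) ≤ ε ∧ μ (itinerary T p (m + 1) ⁻¹' S \ A) ≤ ε)
    (hH : labelEntropy μ l ≠ ⊤) :
    limsup (fun n : ℕ => labelEntropy μ (itinerary T l n) / (n : ℝ≥0∞)) atTop ≤
      limsup (fun n : ℕ => labelEntropy μ (itinerary T p n) / (n : ℝ≥0∞)) atTop := by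
  have hW := tendsto_condEntropy (L := fun m => itinerary T p (m + 1)) hl
    (fun m => hp.itinerary hT.measurable (m + 1)) happ hH
  refine le_of_forall_gt_imp_ge_of_dense fun c hc => ?_
  by_cases hct : c = ⊤
  · simp [hct]
  have h1 : ∀ m, limsup (fun n : ℕ => labelEntropy μ (itinerary T l n) / (n : ℝ≥0∞)) atTop
      ≤ c + condEntropy μ l (itinerary T p (m + 1)) := by
    intro m
    set W := condEntropy μ l (itinerary T p (m + 1))
    have h2 : ∀ᶠ n : ℕ in atTop, labelEntropy μ (itinerary T p n) / (n : ℝ≥0∞) < c :=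
      eventually_lt_of_limsup_lt hc
    have h3 : ∀ᶠ n : ℕ in atTop, labelEntropy μ (itinerary T l n) / (n : ℝ≥0∞)
        ≤ c + c * (m + 1 : ℕ) / n + W := by
      filter_upwards [(tendsto_add_atTop_nat (m + 1)).eventually h2, eventually_gt_atTop 0]
        with n hn hn0
      have hn0' : (n : ℝ≥0∞) ≠ 0 := by simpa using hn0.ne'
      have hnt : (n : ℝ≥0∞) ≠ ⊤ := ENNReal.natCast_ne_top n
      have h4 : labelEntropy μ (itinerary T p (n + (m + 1))) ≤ c * ((n + (m + 1) : ℕ) : ℝ≥0∞) :=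
        (ENNReal.div_le_iff (by simp) (ENNReal.natCast_ne_top _)).1 hn.le
      rw [ENNReal.div_le_iff hn0' hnt]
      refine (labelEntropy_itinerary_le hT hl hp n (m + 1)).trans ?_
      refine (add_le_add h4 le_rfl).trans (le_of_eq ?_)
      rw [add_mul, add_mul, ENNReal.div_mul_cancel hn0' hnt]
      push_cast
      ring
    refine (limsup_le_limsup h3).trans ?_
    have h5 : Tendsto (fun n : ℕ => c + c * (m + 1 : ℕ) / n + W) atTop (𝓝 (c + 0 + W)) := by
      refine Tendsto.add_const _ (Tendsto.const_add _ ?_)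
      have hK : c * (m + 1 : ℕ) ≠ ⊤ := ENNReal.mul_ne_top hct (ENNReal.natCast_ne_top _)
      simpa using ENNReal.Tendsto.const_div ENNReal.tendsto_nat_nhds_top (Or.inr hK)
    rw [add_zero] at h5
    exact h5.limsup_eq.le
  have h6 : Tendsto (fun m => c + condEntropy μ l (itinerary T p (m + 1))) atTop (𝓝 (c + 0)) :=
    tendsto_const_nhds.add hW
  rw [add_zero] at h6
  exact ge_of_tendsto' h6 h1

lemma limsup_labelEntropy_itinerary_le_log_card [Fintype κ] [Nonempty κ] [IsProbabilityMeasure μ]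
    {T : X → X} (hT : Measurable T) {p : X → κ} (hp : IsLabelling p) :
    limsup (fun n : ℕ => labelEntropy μ (itinerary T p n) / (n : ℝ≥0∞)) atTop ≤
      ENNReal.ofReal (Real.log (Fintype.card κ)) := by
  have h1 : ∀ n : ℕ, labelEntropy μ (itinerary T p n) / (n : ℝ≥0∞) ≤
      ENNReal.ofReal (Real.log (Fintype.card κ)) := by
    intro n
    refine ENNReal.div_le_of_le_mul ?_
    refine (labelEntropy_le_log_card (hp.itinerary hT n)).trans (le_of_eq ?_)
    rw [Fintype.card_fun, Fintype.card_fin, Nat.cast_pow, Real.log_pow,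
      ENNReal.ofReal_mul (by positivity), ENNReal.ofReal_natCast, mul_comm]
  exact (limsup_le_limsup (Eventually.of_forall h1)).trans (by simp)

end Generator

end ExpandingMaps

namespace ExpandingMaps

/-! ### From partitions modulo null sets to labellings. -/

section Partitions

variable {X : Type*} [MeasurableSpace X] {μ : Measure X}

lemma IsMeasPartition.countable [IsProbabilityMeasure μ] {Q : Set (Set X)}
    (hQ : IsMeasPartition μ Q) : Q.Countable := by
  have h := Measure.countable_meas_pos_of_disjoint_iUnion₀ (μ := μ) (As := fun A : Q => (A : Set X))
    (fun A => (hQ.measurable A A.2).nullMeasurableSet)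
    (fun A B hAB => hQ.inter_null A A.2 B B.2 fun h => hAB (Subtype.ext h))
  have h2 : {A : Q | 0 < μ (A : Set X)} = Set.univ :=
    Set.eq_univ_of_forall fun A => hQ.pos A A.2
  rw [h2, Set.countable_univ_iff] at h
  exact Set.countable_coe_iff.1 h

/-- A partition is given, up to null sets, by a labelling of the points by its members. -/
lemma IsMeasPartition.exists_labelling [IsProbabilityMeasure μ] {Q : Set (Set X)}
    (hQ : IsMeasPartition μ Q) :
    ∃ l : X → Q, IsLabelling l ∧ ∀ A, l ⁻¹' {A} =ᵐ[μ] (A : Set X) := by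
  classical
  have := hQ.countable.to_subtype
  obtain ⟨D⟩ : Nonempty Q := by
    by_contra hne
    have hemp : Q = ∅ := Set.not_nonempty_iff_eq_empty.1 fun ⟨A, hA⟩ => hne ⟨⟨A, hA⟩⟩
    have := hQ.compl_null
    simp [hemp] at this
  -- Points covered by no member or by two members; this null set receives the dummy label `D`.
  set N : Set X := (⋃₀ Q)ᶜ ∪ ⋃ (A : Q) (B : Q) (_ : A ≠ B), (A : Set X) ∩ B with hN
  have hNm : MeasurableSet N := by
    refine MeasurableSet.union ?_ ?_
    · rw [Set.sUnion_eq_iUnion]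
      exact (MeasurableSet.iUnion fun A : Q => hQ.measurable A A.2).compl
    · exact MeasurableSet.iUnion fun A => MeasurableSet.iUnion fun B => MeasurableSet.iUnion fun _ =>
        (hQ.measurable A A.2).inter (hQ.measurable B B.2)
  have hN0 : μ N = 0 := by
    refine measure_union_null hQ.compl_null ?_
    simp only [measure_iUnion_null_iff]
    exact fun A B hAB => hQ.inter_null A A.2 B B.2 fun h => hAB (Subtype.ext h)
  have huniq : ∀ x ∉ N, ∀ A B : Q, x ∈ (A : Set X) → x ∈ (B : Set X) → A = B := by
    intro x hx A B hA hB
    by_contra hAB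
    refine hx (Or.inr ?_)
    simp only [Set.mem_iUnion]
    exact ⟨A, B, hAB, hA, hB⟩
  let l : X → Q := fun x => if h : x ∉ N ∧ ∃ A : Q, x ∈ (A : Set X) then h.2.choose else D
  have hl : ∀ x ∉ N, ∀ A : Q, l x = A ↔ x ∈ (A : Set X) := by
    intro x hx A
    have hex : ∃ A : Q, x ∈ (A : Set X) := by
      by_contra hne
      refine hx (Or.inl fun hmem => hne ?_)
      obtain ⟨A, hA, hxA⟩ := hmem
      exact ⟨⟨A, hA⟩, hxA⟩
    have hlx : l x = hex.choose := dif_pos ⟨hx, hex⟩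
    rw [hlx]
    exact ⟨fun h => h ▸ hex.choose_spec, fun h => huniq x hx _ _ hex.choose_spec h⟩
  have hlN : ∀ x ∈ N, l x = D := fun x hx => dif_neg fun h => h.1 hx
  refine ⟨l, fun A => ?_, fun A => ?_⟩
  · have : l ⁻¹' {A} = ((A : Set X) \ N) ∪ (if D = A then N else ∅) := by
      ext x
      by_cases hx : x ∈ N
      · have := hlN x hx
        by_cases hA : D = A <;> simp [hx, this, hA]
      · have := hl x hx A
        simp [hx, this]
    rw [this]
    refine ((hQ.measurable A A.2).diff hNm).union ?_
    split_ifs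
    · exact hNm
    · exact MeasurableSet.empty
  · have : ∀ᵐ x ∂μ, x ∉ N := measure_eq_zero_iff_ae_notMem.1 hN0
    filter_upwards [this] with x hx
    exact propext (hl x hx A)

lemma itinerary_preimage_ae_eq {T : X → X} (hT : MeasurePreserving T μ μ) {Q : Set (Set X)}
    {l : X → Q} (hlQ : ∀ A, l ⁻¹' {A} =ᵐ[μ] (A : Set X)) {n : ℕ} (a : Fin n → Q) :
    itinerary T l n ⁻¹' {a} =ᵐ[μ] cyl T fun j => (a j : Set X) := by
  have h1 : itinerary T l n ⁻¹' {a} = ⋂ j : Fin n, T^[(j : ℕ)] ⁻¹' (l ⁻¹' {a j}) := by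
    ext x
    simp [itinerary, funext_iff]
  rw [h1]
  exact Filter.EventuallyEq.countable_iInter fun j =>
    (hT.iterate j).quasiMeasurePreserving.preimage_ae_eq (hlQ (a j))

lemma partitionEntropy_eq {Q : Set (Set X)} {l : X → Q}
    (hlQ : ∀ A, l ⁻¹' {A} =ᵐ[μ] (A : Set X)) : partitionEntropy μ Q = labelEntropy μ l := by
  refine tsum_congr fun A => ?_
  rw [measureReal_congr (hlQ A), Real.negMulLog, one_div, Real.log_inv]
  ring_nf

/-- The join is a set of sets, so null words are absent and words with equal cylinders are
identified. Neither matters: null words contribute zero, and distinct words of positive measure have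
almost disjoint, hence different, cylinders. -/
lemma partitionEntropy_iteratedJoin {T : X → X} (hT : MeasurePreserving T μ μ) {Q : Set (Set X)}
    {l : X → Q} (hlQ : ∀ A, l ⁻¹' {A} =ᵐ[μ] (A : Set X)) (n : ℕ) :
    partitionEntropy μ (iteratedJoin μ T Q n) = labelEntropy μ (itinerary T l n) := by
  let c : (Fin n → Q) → Set X := fun a => cyl T fun j => (a j : Set X)
  have hc : ∀ a, itinerary T l n ⁻¹' {a} =ᵐ[μ] c a := fun a => itinerary_preimage_ae_eq hT hlQ a
  let F : Set X → ℝ≥0∞ := fun A => ENNReal.ofReal (μ.real A * Real.log (1 / μ.real A))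
  have h1 : labelEntropy μ (itinerary T l n) = ∑' a, F (c a) := by
    refine tsum_congr fun a => ?_
    simp only [F]
    rw [measureReal_congr (hc a), Real.negMulLog, one_div, Real.log_inv]
    ring_nf
  let S : Set (Fin n → Q) := {a | 0 < μ (c a)}
  have h2 : iteratedJoin μ T Q n = c '' S := by
    ext A
    constructor
    · rintro ⟨hA, a, ha, rfl⟩
      exact ⟨fun j => ⟨a j, ha j⟩, hA, rfl⟩
    · rintro ⟨a, ha, rfl⟩
      exact ⟨ha, fun j => a j, fun j => (a j).2, rfl⟩
  have hinj : Set.InjOn c S := by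
    intro a ha b _ hab
    by_contra hne
    have h3 : itinerary T l n ⁻¹' {a} =ᵐ[μ] itinerary T l n ⁻¹' {b} :=
      (hc a).trans ((Eq.eventuallyEq hab).trans (hc b).symm)
    have h4 : itinerary T l n ⁻¹' {a} ∩ itinerary T l n ⁻¹' {b} = ∅ := by
      ext x
      simp only [Set.mem_inter_iff, Set.mem_preimage, Set.mem_singleton_iff,
        Set.mem_empty_iff_false, iff_false, not_and]
      exact fun h h' => hne (h.symm.trans h')
    have h5 : μ (itinerary T l n ⁻¹' {a}) = 0 := by
      have h6 := (ae_eq_refl (itinerary T l n ⁻¹' {a})).inter h3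
      rw [Set.inter_self, h4] at h6
      rw [measure_congr h6, measure_empty]
    rw [measure_congr (hc a)] at h5
    exact (ne_of_gt ha) h5
  change ∑' A : iteratedJoin μ T Q n, F A = _
  rw [h1, h2, tsum_image F hinj]
  refine tsum_subtype_eq_of_support_subset (f := fun a => F (c a)) (s := S) fun a ha => ?_
  change 0 < μ (c a)
  refine pos_iff_ne_zero.2 fun h0 => ha ?_
  simp [F, measureReal_def, h0]

lemma entropyWrt_eq {T : X → X} (hT : MeasurePreserving T μ μ) {Q : Set (Set X)}
    {l : X → Q} (hlQ : ∀ A, l ⁻¹' {A} =ᵐ[μ] (A : Set X)) :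
    entropyWrt μ T Q =
      limsup (fun n : ℕ => labelEntropy μ (itinerary T l n) / (n : ℝ≥0∞)) atTop := by
  simp only [entropyWrt, partitionEntropy_iteratedJoin hT hlQ]

end Partitions

section System

variable {X : Type*} [MetricSpace X] [MeasurableSpace X] [BorelSpace X] {lam μ : Measure X}
  {T : X → X} {P0 : Set (Set X)}

lemma IsACIPM.isMeasPartition (hμ : IsACIPM lam T μ) (h : IsExpandingSystem lam T P0)
    (hfin : P0.Finite) : IsMeasPartition μ P0 where
  measurable := fun _ hA => h.measurableSet_of_mem hA
  pos := fun A hA => by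
    obtain ⟨C, -, hcmp⟩ := hμ.exists_comparable h hfin
    refine pos_iff_ne_zero.2 fun h0 => (h.measure_pos A hA).ne' ?_
    simpa [h0] using (hcmp A (h.measurableSet_of_mem hA)).2
  inter_null := fun A hA B hB hAB => by rw [h.disjoint A hA B hB hAB, measure_empty]
  compl_null := hμ.abs_cont h.compl_null

lemma IsACIPM.measureEntropy_le_entropyWrt (hμ : IsACIPM lam T μ) (h : IsExpandingSystem lam T P0)
    (hfin : P0.Finite) : measureEntropy μ T ≤ entropyWrt μ T P0 := by
  have := hμ.probability
  have := hfin.fintype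
  refine iSup_le fun Q => iSup_le fun hQ => iSup_le fun hH => ?_
  have := hQ.countable.to_subtype
  obtain ⟨q, hq, hqQ⟩ := hQ.exists_labelling
  obtain ⟨p, hp, hpP⟩ := (hμ.isMeasPartition h hfin).exists_labelling
  rw [entropyWrt_eq hμ.invariant hqQ, entropyWrt_eq hμ.invariant hpP]
  rw [partitionEntropy_eq hqQ] at hH
  refine limsup_labelEntropy_itinerary_le hμ.invariant hq hp (fun A hA ε hε => ?_) hH.ne
  filter_upwards [h.exists_approx_cyl (hμ.X0_compl_null h) hA hε] with m hm
  obtain ⟨S, hS1, hS2⟩ := hm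
  have hae : itinerary T p (m + 1) ⁻¹' S =ᵐ[μ] ⋃ b ∈ S, cyl T fun j => (b j : Set X) := by
    rw [← Set.biUnion_preimage_singleton]
    exact Filter.EventuallyEq.countable_bUnion S.to_countable fun b _ =>
      itinerary_preimage_ae_eq hμ.invariant hpP b
  refine ⟨S, ?_, ?_⟩
  · rwa [measure_congr ((ae_eq_refl A).diff hae)]
  · rwa [measure_congr (hae.diff (ae_eq_refl A))]

lemma IsACIPM.entropyWrt_le_log_ncard (hμ : IsACIPM lam T μ) (h : IsExpandingSystem lam T P0)
    (hfin : P0.Finite) : entropyWrt μ T P0 ≤ ENNReal.ofReal (Real.log (P0.ncard : ℝ)) := by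
  have := hμ.probability
  have := hfin.fintype
  obtain ⟨p, hp, hpP⟩ := (hμ.isMeasPartition h hfin).exists_labelling
  have : Nonempty P0 := by
    by_contra hne
    have hemp : IsEmpty P0 := not_nonempty_iff.1 hne
    have : IsEmpty X := ⟨fun x => hemp.false (p x)⟩
    have h1 := measure_univ (μ := μ)
    rw [Set.univ_eq_empty_iff.2 this, measure_empty] at h1
    exact zero_ne_one h1
  rw [entropyWrt_eq hμ.invariant hpP, Set.ncard_eq_toFinset_card', Set.toFinset_card]
  exact limsup_labelEntropy_itinerary_le_log_card hμ.invariant.measurable hp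

end System

end ExpandingMaps

namespace ExpandingMaps

/-! ### Grid measures: change of measure and vanishing criteria. -/

section GridDimension

variable {X : Type*} [MeasurableSpace X] {grid : ℕ → Set (Set X)} {ν ν' : Measure X} {F : Set X}

lemma gridMeasure_eq_zero_of_le {C : ℝ≥0∞} (hC : C ≠ ⊤) (hle : ∀ n, ∀ B ∈ grid n, ν B ≤ C * ν' B)
    {α : ℝ} (hα : 0 < α) (h0 : gridMeasure grid ν' α F = 0) : gridMeasure grid ν α F = 0 := by
  simp only [gridMeasure, ENNReal.iSup_eq_zero] at h0 ⊢
  intro n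
  have h1 : gridPreMeasure grid ν α n F / C ^ α ≤ gridPreMeasure grid ν' α n F := by
    refine le_iInf fun S => le_iInf fun hS => le_iInf fun hF => ?_
    refine ENNReal.div_le_of_le_mul ?_
    refine (iInf₂_le_of_le S hS (iInf_le _ hF)).trans ?_
    rw [← ENNReal.tsum_mul_right]
    refine ENNReal.tsum_le_tsum fun B => ?_
    have hB := hS B.2
    simp only [Set.mem_iUnion] at hB
    obtain ⟨k, -, hk⟩ := hB
    rw [← ENNReal.mul_rpow_of_nonneg _ _ hα.le, mul_comm]
    exact ENNReal.rpow_le_rpow (hle k B hk) hα.le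
  rw [h0 n, nonpos_iff_eq_zero, ENNReal.div_eq_zero_iff] at h1
  exact h1.resolve_right (ENNReal.rpow_ne_top_of_nonneg hα.le hC)

/-- The dimension only records for which exponents the grid measure vanishes, and bounded factors do
not affect this. -/
lemma gridDim_eq_of_comparable {C : ℝ≥0∞} (hC : C ≠ ⊤)
    (hle : ∀ n, ∀ B ∈ grid n, ν B ≤ C * ν' B ∧ ν' B ≤ C * ν B) :
    gridDim grid ν F = gridDim grid ν' F := by
  refine iSup_congr fun α => iSup_congr fun hα => iSup_congr fun _ => iSup_congr_Prop ?_ fun _ => rfl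
  rw [pos_iff_ne_zero, pos_iff_ne_zero, not_iff_not]
  exact ⟨gridMeasure_eq_zero_of_le hC (fun n B hB => (hle n B hB).2) hα,
    gridMeasure_eq_zero_of_le hC (fun n B hB => (hle n B hB).1) hα⟩

lemma gridDim_le_one : gridDim grid ν F ≤ 1 :=
  iSup_le fun _ => iSup_le fun _ => iSup_le fun h => iSup_le fun _ => ENNReal.ofReal_le_one.2 h

/-- Concavity of s ↦ s^α, used as the power-mean inequality with exponent 1 / α. -/
lemma sum_rpow_le_card_mul {κ : Type*} (s : Finset κ) (f : κ → ℝ≥0∞) {α : ℝ} (hα : 0 < α)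
    (hα1 : α ≤ 1) : ∑ b ∈ s, f b ^ α ≤ (s.card : ℝ≥0∞) ^ (1 - α) * (∑ b ∈ s, f b) ^ α := by
  have h1 := ENNReal.rpow_sum_le_const_mul_sum_rpow s (fun b => f b ^ α) (p := α⁻¹)
    ((one_le_inv₀ hα).2 hα1)
  simp only [← ENNReal.rpow_mul, mul_inv_cancel₀ hα.ne', ENNReal.rpow_one] at h1
  have h2 := ENNReal.rpow_le_rpow h1 hα.le
  rw [← ENNReal.rpow_mul, inv_mul_cancel₀ hα.ne', ENNReal.rpow_one,
    ENNReal.mul_rpow_of_nonneg _ _ hα.le, ← ENNReal.rpow_mul] at h2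
  have h3 : (α⁻¹ - 1) * α = 1 - α := by field_simp
  rwa [h3] at h2

/-- If `F` is covered infinitely often by families `S k` drawn from the grid, with summable
contributions, then its grid measure vanishes. -/
lemma gridMeasure_eq_zero_of_summable {α : ℝ} {S : ℕ → Set (Set X)} {a : ℕ → ℝ≥0∞}
    (hS : ∀ k, S k ⊆ ⋃ j ≥ k, grid j) (hF : ∀ x ∈ F, ∃ᶠ k in atTop, x ∈ ⋃₀ S k)
    (ha : ∀ᶠ k in atTop, ∑' A : S k, ν (A : Set X) ^ α ≤ a k) (hsum : ∑' k, a k ≠ ⊤) :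
    gridMeasure grid ν α F = 0 := by
  simp only [gridMeasure, ENNReal.iSup_eq_zero]
  intro n
  rw [← nonpos_iff_eq_zero]
  -- For every large `N` the families with index at least `N` together cover `F`, at a cost bounded
  -- by a tail of the convergent series.
  refine ge_of_tendsto (ENNReal.tendsto_sum_nat_add a hsum) ?_
  obtain ⟨N₀, hN₀⟩ := eventually_atTop.1 ha
  filter_upwards [eventually_ge_atTop (max n N₀)] with N hN
  have hnN : n ≤ N := (le_max_left _ _).trans hN
  refine (iInf₂_le_of_le (⋃ k, S (k + N)) ?_ (iInf_le_of_le ?_ le_rfl)).trans ?_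
  · refine Set.iUnion_subset fun k => (hS _).trans ?_
    exact Set.biUnion_subset_biUnion_left fun j hj => by
      have : k + N ≤ j := hj
      change n ≤ j
      omega
  · intro x hx
    obtain ⟨k, hk, A, hA, hxA⟩ := frequently_atTop.1 (hF x hx) N
    refine ⟨A, Set.mem_iUnion.2 ⟨k - N, ?_⟩, hxA⟩
    rwa [Nat.sub_add_cancel hk]
  · refine (ENNReal.tsum_iUnion_le_tsum (fun A : Set X => ν A ^ α) fun k => S (k + N)).trans ?_
    refine ENNReal.tsum_le_tsum fun k => hN₀ _ ?_
    have := (le_max_right n N₀).trans hN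
    omega

lemma eventually_le_exp_of_lt_lowerL {lam : Measure X} [IsFiniteMeasure lam] {P : ℕ → Set X} {t : ℕ → ℕ} {r : ℝ}
    (hlt : ENNReal.ofReal r < lowerL lam P t) :
    ∀ᶠ n : ℕ in atTop, lam (P (t n)) ≤ ENNReal.ofReal (Real.exp (-(n * r))) := by
  have h1 : (r : EReal) < liminf (fun n : ℕ =>
      ((1 / (n : ℝ) * Real.log (1 / lam.real (P (t n))) : ℝ) : EReal)) atTop := by
    by_contra hle
    refine not_le.2 hlt ?_
    rw [lowerL]
    refine (EReal.toENNReal_le_toENNReal (not_lt.1 hle)).trans (le_of_eq ?_)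
    exact EReal.toENNReal_of_ne_top (EReal.coe_ne_top r)
  filter_upwards [eventually_lt_of_lt_liminf h1, eventually_gt_atTop 0] with n hn hn0
  rw [EReal.coe_lt_coe_iff, one_div, ← div_eq_inv_mul, lt_div_iff₀ (by positivity), one_div,
    Real.log_inv] at hn
  rw [← ofReal_real]
  refine ENNReal.ofReal_le_ofReal ?_
  rcases (measureReal_nonneg (μ := lam) (s := P (t n))).eq_or_lt with h0 | h0
  · rw [← h0]
    exact Real.exp_nonneg _
  · rw [← Real.log_le_iff_le_exp h0]
    linarith

end GridDimension

/-! ### Covering the shrinking target set. -/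

section System

variable {X : Type*} [MetricSpace X] [MeasurableSpace X] [BorelSpace X] {lam μ : Measure X}
  {T : X → X} {P0 : Set (Set X)}

/-- The preimage of a block under an iterate of `T` is covered by blocks with controlled
measures. -/
lemma IsExpandingSystem.exists_cover (h : IsExpandingSystem lam T P0) (hfin : P0.Finite)
    (hT : MeasurePreserving T μ μ) {t : ℕ} {R : Set X} (hR : R ∈ blocks T P0 t) (k : ℕ) {α : ℝ}
    (hα : 0 < α) (hα1 : α ≤ 1) :
    ∃ S ⊆ blocks T P0 (t + k), X0 T P0 ∩ T^[k] ⁻¹' R ⊆ ⋃₀ S ∧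
      ∑' A : S, μ (A : Set X) ^ α ≤ ((P0.ncard ^ k : ℕ) : ℝ≥0∞) ^ (1 - α) * μ R ^ α := by
  have := hfin.fintype
  let g : (Fin k → P0) → Set X := fun b => (cyl T fun j => (b j : Set X)) ∩ T^[k] ⁻¹' R
  have hRm := h.measurableSet_of_mem_blocks hR
  have hgm : ∀ b, MeasurableSet (g b) := fun b =>
    (measurableSet_cyl h.measurable_map fun j => h.measurableSet_of_mem (b j).2).inter
      (h.measurable_map.iterate k hRm)
  refine ⟨{A | A.Nonempty ∧ ∃ b, g b = A}, ?_, ?_, ?_⟩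
  · rintro _ ⟨hne, b, rfl⟩
    exact pullback_mem_blocks h.markov hR _ (fun j => (b j).2) hne
  · rintro x ⟨hx0, hxR⟩
    obtain ⟨b, hb⟩ := exists_mem_cyl_of_mem_X0 hx0 k
    exact ⟨g b, ⟨⟨x, hb, hxR⟩, b, rfl⟩, hb, hxR⟩
  · choose b hb using fun A : {A : Set X | A.Nonempty ∧ ∃ b, g b = A} => A.2.2
    have hinj : Function.Injective b := fun A B hAB =>
      Subtype.ext ((hb A).symm.trans ((congrArg g hAB).trans (hb B)))
    calc ∑' A : {A : Set X | A.Nonempty ∧ ∃ b, g b = A}, μ (A : Set X) ^ α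
        = ∑' A : {A : Set X | A.Nonempty ∧ ∃ b, g b = A}, μ (g (b A)) ^ α :=
          tsum_congr fun A => by rw [hb]
      _ ≤ ∑' b, μ (g b) ^ α :=
          ENNReal.tsum_comp_le_tsum_of_injective hinj fun b => μ (g b) ^ α
      _ = ∑ b, μ (g b) ^ α := tsum_fintype _
      _ ≤ _ := sum_rpow_le_card_mul _ _ hα hα1
      _ ≤ _ := by
          rw [Finset.card_univ, Fintype.card_fun, Fintype.card_fin,
            Set.ncard_eq_toFinset_card', Set.toFinset_card]
          gcongr
          have hd : Pairwise fun b c => Disjoint (g b) (g c) := fun b c hbc =>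
            (disjoint_cyl h.disjoint hbc).mono Set.inter_subset_left Set.inter_subset_left
          rw [← tsum_fintype (L := .unconditional _), ← measure_iUnion hd hgm,
            ← (hT.iterate k).measure_preimage hRm.nullMeasurableSet]
          exact measure_mono (Set.iUnion_subset fun b => Set.inter_subset_right)

/-- With a single letter there is at most one cylinder of each length, so shrinking diameters reduce
`X0` to at most a point. That is null for a non-atomic measure, although `X0` has full μ-measure. -/
lemma IsACIPM.one_lt_ncard (hμ : IsACIPM lam T μ) (h : IsExpandingSystem lam T P0)
    (hfin : P0.Finite) : 1 < P0.ncard := by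
  have := hμ.probability
  have := h.non_atomic
  by_contra hle
  have := hfin.to_subtype
  have hsub : P0.Subsingleton :=
    Set.ncard_le_one_iff_subsingleton.1 (not_lt.1 hle)
  have hX0 : (X0 T P0).Subsingleton := by
    intro x hx y hy
    obtain ⟨c, γ, hc, hγ0, hγ1, hdist⟩ := h.exists_dist_le
    have h1 : ∀ n, dist x y ≤ c * γ ^ n := by
      intro n
      obtain ⟨B, hB, hxB⟩ := Set.mem_iInter.1 hx n
      obtain ⟨B', hB', hyB'⟩ := Set.mem_iInter.1 hy n
      obtain ⟨b, rfl⟩ := exists_cyl_of_mem_blocks hB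
      obtain ⟨b', rfl⟩ := exists_cyl_of_mem_blocks hB'
      have : b = b' := funext fun j => Subtype.ext (hsub (b j).2 (b' j).2)
      subst this
      exact hdist n _ hB x hxB y hyB'
    have h2 : Tendsto (fun n => c * γ ^ n) atTop (𝓝 0) := by
      simpa using (tendsto_pow_atTop_nhds_zero_of_lt_one hγ0 hγ1).const_mul c
    exact dist_le_zero.1 (ge_of_tendsto' h2 h1)
  have h3 : μ (X0 T P0) = 0 := hμ.abs_cont (hX0.measure_zero lam)
  have h4 : μ Set.univ = 0 := by
    rw [← Set.union_compl_self (X0 T P0)]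
    exact measure_union_null h3 (hμ.X0_compl_null h)
  rw [measure_univ] at h4
  exact one_ne_zero h4

lemma IsBlockSeq.mem_blocks (h : IsExpandingSystem lam T P0) {x₀ : X} {P : ℕ → Set X}
    (hP : IsBlockSeq T P0 x₀ P) (n : ℕ) : P n ∈ blocks T P0 n := by
  rcases hP with ⟨hx, hP⟩ | ⟨-, hP⟩
  · rw [hP]
    exact block_mem_blocks h.disjoint hx n
  · exact hP.1 n

lemma IsACIPM.gridMeasure_shrinkingTargetSet_eq_zero (hμ : IsACIPM lam T μ)
    (h : IsExpandingSystem lam T P0) (hfin : P0.Finite) {U : Set X} {P : ℕ → Set X}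
    (hP : ∀ n, P n ∈ blocks T P0 n) {t : ℕ → ℕ} {α r : ℝ} (hα : 0 < α) (hα1 : α ≤ 1)
    (hlt : Real.log (P0.ncard : ℝ) < α * (Real.log (P0.ncard : ℝ) + r))
    (hr : ∀ᶠ n : ℕ in atTop, lam (P (t n)) ≤ ENNReal.ofReal (Real.exp (-(n * r)))) :
    gridMeasure (blocks T P0) μ α (shrinkingTargetSet T P0 U P t) = 0 := by
  obtain ⟨C, hC, hcmp⟩ := hμ.exists_comparable h hfin
  choose S hS hcov hsum using fun k => h.exists_cover hfin hμ.invariant (hP (t k)) k hα hα1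
  set d := Real.log (P0.ncard : ℝ) with hd
  have hD : (0 : ℝ) < P0.ncard := by
    exact_mod_cast zero_lt_one.trans (hμ.one_lt_ncard h hfin)
  -- The ratio of the geometric series of covering costs; `hlt` says exactly that its exponent is
  -- negative.
  set ρ : ℝ := Real.exp ((1 - α) * d - α * r) with hρ
  refine gridMeasure_eq_zero_of_summable (S := S)
    (a := fun k => C ^ α * ENNReal.ofReal ρ ^ k) ?_ ?_ ?_ ?_
  · intro k
    refine (hS k).trans ?_
    exact Set.subset_biUnion_of_mem (u := fun j => blocks T P0 j) (show t k + k ≥ k by omega)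
  · rintro x ⟨hx, hfreq⟩
    exact hfreq.mono fun k hk => hcov k ⟨hx.2, hk⟩
  · filter_upwards [hr] with k hk
    refine (hsum k).trans ?_
    have h1 : μ (P (t k)) ^ α ≤ C ^ α * ENNReal.ofReal (Real.exp (-(k * r) * α)) := by
      rw [Real.exp_mul, ← ENNReal.ofReal_rpow_of_pos (Real.exp_pos _),
        ← ENNReal.mul_rpow_of_nonneg _ _ hα.le]
      refine ENNReal.rpow_le_rpow ?_ hα.le
      exact (hcmp _ (h.measurableSet_of_mem_blocks (hP _))).1.trans (by gcongr)
    have h2 : ((P0.ncard ^ k : ℕ) : ℝ≥0∞) ^ (1 - α)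
        = ENNReal.ofReal (Real.exp (k * d * (1 - α))) := by
      rw [Real.exp_mul, ← ENNReal.ofReal_rpow_of_pos (Real.exp_pos _), Real.exp_nat_mul,
        hd, Real.exp_log hD, ← ENNReal.ofReal_natCast]
      push_cast
      rfl
    calc _ ≤ ENNReal.ofReal (Real.exp (k * d * (1 - α))) *
          (C ^ α * ENNReal.ofReal (Real.exp (-(k * r) * α))) := by
          rw [h2]
          exact mul_le_mul' le_rfl h1
      _ = C ^ α * ENNReal.ofReal ρ ^ k := by
          rw [mul_left_comm, ← ENNReal.ofReal_mul (Real.exp_nonneg _), ← Real.exp_add,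
            ← ENNReal.ofReal_pow (Real.exp_nonneg _), ← Real.exp_nat_mul]
          congr 3
          ring
  · rw [ENNReal.tsum_mul_left, ENNReal.tsum_geometric]
    refine ENNReal.mul_ne_top (ENNReal.rpow_ne_top_of_nonneg hα.le hC) (ENNReal.inv_ne_top.2 ?_)
    refine (tsub_pos_of_lt ?_).ne'
    rw [ENNReal.ofReal_lt_one, hρ, Real.exp_lt_one_iff]
    linarith

/-- The proof works with the sharper denominator log D + L; allowing any smaller `H` serves both
bounds of the theorem. -/
lemma IsACIPM.gridDim_shrinkingTargetSet_le (hμ : IsACIPM lam T μ)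
    (h : IsExpandingSystem lam T P0) (hfin : P0.Finite) {U : Set X} {P : ℕ → Set X}
    (hP : ∀ n, P n ∈ blocks T P0 n) {t : ℕ → ℕ} {H : ℝ≥0∞}
    (hH : H ≤ ENNReal.ofReal (Real.log (P0.ncard : ℝ)) + lowerL lam P t) :
    gridDim (blocks T P0) μ (shrinkingTargetSet T P0 U P t) ≤
      ENNReal.ofReal (Real.log (P0.ncard : ℝ)) / H := by
  have := h.finite_measure
  have hd : 0 < Real.log (P0.ncard : ℝ) :=
    Real.log_pos (by exact_mod_cast hμ.one_lt_ncard h hfin)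
  set d := Real.log (P0.ncard : ℝ) with hd_def
  refine iSup_le fun α => iSup_le fun hα => iSup_le fun hα1 => iSup_le fun hpos => ?_
  -- Positivity of log D covers `H = 0`, its finiteness covers `H = ⊤`.
  rw [ENNReal.le_div_iff_mul_le (Or.inr (by simpa using hd)) (Or.inr ENNReal.ofReal_ne_top)]
  by_contra hlt
  rw [not_le] at hlt
  have h1 : ENNReal.ofReal d < ENNReal.ofReal α * (ENNReal.ofReal d + lowerL lam P t) :=
    hlt.trans_le (by gcongr)
  have hα0 : ENNReal.ofReal α ≠ 0 := by simpa using hα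
  have h2 : ENNReal.ofReal (d / α - d) < lowerL lam P t := by
    have h3 : ENNReal.ofReal (d / α) < ENNReal.ofReal d + lowerL lam P t := by
      rw [ENNReal.ofReal_div_of_pos hα]
      exact ENNReal.div_lt_of_lt_mul' h1
    rw [ENNReal.ofReal_sub _ hd.le]
    refine ENNReal.sub_lt_of_lt_add ?_ ?_
    · refine ENNReal.ofReal_le_ofReal ?_
      rw [le_div_iff₀ hα]
      nlinarith
    · rwa [add_comm]
  have h4 : 0 ≤ d / α - d := by
    rw [sub_nonneg, le_div_iff₀ hα]
    nlinarith
  -- A decay rate strictly between the threshold d / α - d and the lower rate, which may be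
  -- infinite.
  obtain ⟨s, hs1, hs2⟩ := ENNReal.lt_iff_exists_nnreal_btwn.1 h2
  have hs3 : d / α - d < s := by
    rwa [← ENNReal.ofReal_coe_nnreal, ENNReal.ofReal_lt_ofReal_iff_of_nonneg h4] at hs1
  rw [← ENNReal.ofReal_coe_nnreal] at hs2
  refine hpos.ne' (hμ.gridMeasure_shrinkingTargetSet_eq_zero h hfin hP hα hα1 (r := s) ?_
    (eventually_le_exp_of_lt_lowerL hs2))
  have h5 : d / α < d + s := by linarith
  rwa [div_lt_iff₀' hα] at h5

/-- At a point of `X1` the exponential rate of decay of the measures of the blocks is the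
entropy. -/
lemma IsACIPM.lowerW_mul_le_lowerL (hμ : IsACIPM lam T μ)
    (h : IsExpandingSystem lam T P0) (hfin : P0.Finite) {x₀ : X} (hx₀ : x₀ ∈ X1 μ T P0) {t : ℕ → ℕ}
    {P : ℕ → Set X} (hP : ∀ n, P n = block T P0 n x₀) :
    lowerW t * entropyWrt μ T P0 ≤ lowerL lam P t := by
  have := h.finite_measure
  have := hμ.probability
  obtain ⟨C, hC, hcmp⟩ := hμ.exists_comparable h hfin
  have hPb : ∀ n, P n ∈ blocks T P0 n := fun n => by
    rw [hP]
    exact block_mem_blocks h.disjoint hx₀.1 n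
  have hlam : ∀ n, 0 < lam.real (P n) := fun n =>
    ENNReal.toReal_pos (h.measure_block_pos (hPb n)).ne' (measure_ne_top _ _)
  have hcmp' : ∀ n, lam.real (P n) ≤ C.toReal * μ.real (P n) := fun n => by
    rw [measureReal_def, measureReal_def, ← ENNReal.toReal_mul]
    exact ENNReal.toReal_mono (by finiteness) (hcmp _ (h.measurableSet_of_mem_blocks (hPb n))).2
  -- Makes the `toReal` in the definition of `X1` faithful.
  have hfinite : entropyWrt μ T P0 ≠ ⊤ :=
    ne_top_of_le_ne_top ENNReal.ofReal_ne_top (hμ.entropyWrt_le_log_ncard h hfin)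
  -- Both factors are approximated from below by finite numbers, since `lowerW t` may be infinite.
  -- The case `a' = 0` is trivial; otherwise t n tends to infinity, so the estimate at `x₀` applies
  -- at index t n.
  refine ENNReal.mul_le_of_forall_lt fun a' ha' b' hb' => ?_
  lift a' to ℝ≥0 using ha'.ne_top
  lift b' to ℝ≥0 using hb'.ne_top
  rcases eq_or_ne a' 0 with rfl | ha0
  · simp
  have ha0' : (0 : ℝ) < a' := by positivity
  have hb : (b' : ℝ) < (entropyWrt μ T P0).toReal := by
    have := (ENNReal.toReal_lt_toReal ENNReal.coe_ne_top hfinite).2 hb'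
    simpa using this
  obtain ⟨m, hm⟩ := exists_nat_one_div_lt (sub_pos.2 hb)
  obtain ⟨N, hN⟩ : ∃ N : ℕ, ∀ j ≥ N, |1 / (j : ℝ) * Real.log (1 / μ.real (block T P0 j x₀))
      - (entropyWrt μ T P0).toReal| < 1 / ((m : ℝ) + 1) := by
    by_contra hcon
    push Not at hcon
    refine hx₀.2 (Set.mem_iUnion.2 ⟨m, Set.mem_iInter.2 fun N => ?_⟩)
    obtain ⟨j, hj, hj'⟩ := hcon N
    exact ⟨j, hj, not_lt.2 hj'⟩
  have ht : ∀ᶠ n : ℕ in atTop, (a' : ℝ) * n < t n := by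
    filter_upwards [eventually_lt_of_lt_liminf ha', eventually_gt_atTop 0] with n hn hn0
    rw [ENNReal.lt_div_iff_mul_lt (Or.inl (by simpa using hn0.ne'))
      (Or.inl (ENNReal.natCast_ne_top n))] at hn
    exact_mod_cast hn
  have htN : ∀ᶠ n : ℕ in atTop, (N : ℝ) < t n := by
    have h1 : Tendsto (fun n : ℕ => (a' : ℝ) * n) atTop atTop :=
      tendsto_natCast_atTop_atTop.const_mul_atTop ha0'
    filter_upwards [h1.eventually_gt_atTop (N : ℝ), ht] with n hn1 hn2
    exact hn1.trans hn2
  -- Passing from μ to λ costs log C / n, which vanishes in the limit.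
  have hlow : ∀ᶠ n : ℕ in atTop, (((a' : ℝ) * b' - Real.log C.toReal / n : ℝ) : EReal) ≤
      ((1 / (n : ℝ) * Real.log (1 / lam.real (P (t n))) : ℝ) : EReal) := by
    filter_upwards [ht, htN, eventually_gt_atTop 0] with n hn hnN hn0
    rw [EReal.coe_le_coe_iff]
    have hn0' : (0 : ℝ) < n := by exact_mod_cast hn0
    have htpos : (0 : ℝ) < t n := (Nat.cast_nonneg N).trans_lt hnN
    have h1 := (abs_lt.1 (hN (t n) (by exact_mod_cast hnN.le))).1
    rw [← hP] at h1
    have h2 : (b' : ℝ) < 1 / (t n : ℝ) * Real.log (1 / μ.real (P (t n))) := by linarith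
    rw [one_div, ← div_eq_inv_mul, lt_div_iff₀ htpos, one_div, Real.log_inv] at h2
    have h3 := hcmp' (t n)
    have h4 := hlam (t n)
    have hCμ : 0 < C.toReal * μ.real (P (t n)) := h4.trans_le h3
    have hC0 : C.toReal ≠ 0 := fun h0 => by simp [h0] at hCμ
    have hμ0 : μ.real (P (t n)) ≠ 0 := fun h0 => by simp [h0] at hCμ
    have h5 := Real.log_le_log h4 h3
    rw [Real.log_mul hC0 hμ0] at h5
    rw [one_div, ← div_eq_inv_mul, le_div_iff₀ hn0', one_div, Real.log_inv, sub_mul,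
      div_mul_cancel₀ _ hn0'.ne']
    have h6 : (b' : ℝ) * (a' * n) ≤ b' * t n := by gcongr
    linarith
  have hlim : Tendsto (fun n : ℕ => (((a' : ℝ) * b' - Real.log C.toReal / n : ℝ) : EReal)) atTop
      (𝓝 (((a' : ℝ) * b' : ℝ) : EReal)) := by
    refine EReal.tendsto_coe.2 ?_
    simpa using tendsto_const_nhds.sub (tendsto_const_div_atTop_nhds_zero_nat (Real.log C.toReal))
  have hfinal := hlim.liminf_eq.symm.le.trans (liminf_le_liminf hlow)
  rw [lowerL]
  refine le_trans (le_of_eq ?_) (EReal.toENNReal_le_toENNReal hfinal)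
  rw [EReal.toENNReal_of_ne_top (EReal.coe_ne_top _), EReal.toReal_coe,
    ENNReal.ofReal_mul a'.coe_nonneg, ENNReal.ofReal_coe_nnreal, ENNReal.ofReal_coe_nnreal]

end System

end ExpandingMaps

/-! ### The proposition. -/

theorem mainTheorem7 {X : Type*} [MetricSpace X] [MeasurableSpace X] [BorelSpace X]
    (lam : Measure X) (T : X → X) (P0 : Set (Set X))
    (hsys : ExpandingMaps.IsExpandingSystem lam T P0) (hfin : P0.Finite)
    (μ : Measure X) (hμ : ExpandingMaps.IsACIPM lam T μ)
    (t : ℕ → ℕ) (ht_mono : Monotone t) (ht_pos : ∀ n, 0 < t n)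
    (U : Set X) (hU_open : IsOpen U) (hU_pos : 0 < μ U)
    (x₀ : X) (hx₀ : x₀ ∈ ExpandingMaps.X0plus T P0)
    (P : ℕ → Set X) (hP : ExpandingMaps.IsBlockSeq T P0 x₀ P) :
    ExpandingMaps.gridDim (ExpandingMaps.blocks T P0) lam
        (ExpandingMaps.shrinkingTargetSet T P0 U P t)
      = ExpandingMaps.gridDim (ExpandingMaps.blocks T P0) μ
        (ExpandingMaps.shrinkingTargetSet T P0 U P t) ∧
    ExpandingMaps.gridDim (ExpandingMaps.blocks T P0) lam
        (ExpandingMaps.shrinkingTargetSet T P0 U P t)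
      ≤ min 1 (ENNReal.ofReal (Real.log (P0.ncard : ℝ)) /
          (ExpandingMaps.measureEntropy μ T + ExpandingMaps.lowerL lam P t)) ∧
    (x₀ ∈ ExpandingMaps.X1 μ T P0 →
      ExpandingMaps.gridDim (ExpandingMaps.blocks T P0) lam
          (ExpandingMaps.shrinkingTargetSet T P0 U P t)
        ≤ min 1 (ENNReal.ofReal (Real.log (P0.ncard : ℝ)) /
            ((1 + ExpandingMaps.lowerW t) * ExpandingMaps.measureEntropy μ T))) := by
  obtain ⟨C, hC, hcmp⟩ := hμ.exists_comparable hsys hfin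
  have hblocks := ExpandingMaps.IsBlockSeq.mem_blocks hsys hP
  have hle := hμ.measureEntropy_le_entropyWrt hsys hfin
  have hlog := hμ.entropyWrt_le_log_ncard hsys hfin
  have heq : ExpandingMaps.gridDim (ExpandingMaps.blocks T P0) lam (ExpandingMaps.shrinkingTargetSet T P0 U P t)
      = ExpandingMaps.gridDim (ExpandingMaps.blocks T P0) μ (ExpandingMaps.shrinkingTargetSet T P0 U P t) :=
    ExpandingMaps.gridDim_eq_of_comparable hC fun n B hB =>
      (hcmp B (hsys.measurableSet_of_mem_blocks hB)).symm
  refine ⟨heq, le_min ExpandingMaps.gridDim_le_one ?_, fun hx₁ => le_min ExpandingMaps.gridDim_le_one ?_⟩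
  · rw [heq]
    refine hμ.gridDim_shrinkingTargetSet_le hsys hfin hblocks ?_
    gcongr
    exact hle.trans hlog
  · rw [heq]
    refine hμ.gridDim_shrinkingTargetSet_le hsys hfin hblocks ?_
    have hPblock : ∀ n, P n = ExpandingMaps.block T P0 n x₀ := by
      rcases hP with ⟨-, hP⟩ | ⟨hx, -⟩
      · exact hP
      · exact absurd hx₁.1 hx
    rw [add_mul, one_mul]
    -- `X1` controls the rate h_μ(T, `P0`), which dominates the h_μ(T) of the statement; only this
    -- direction is needed.
    refine add_le_add (hle.trans hlog) (le_trans ?_ (hμ.lowerW_mul_le_lowerL hsys hfin hx₁ hPblock))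
    gcongr
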